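/- Let $n\ge1$, $k\ge0$ and let $A,C\in\mathbb R^{n\times n}$, $B,D\in\mathbb R^{n\times k}$, $L\in\mathbb R^{k\times n}$, $Q\in\mathbb R^{n\times n}$, $R\in\mathbb R^{k\times k}$ be constant real matrices such that the block matrix $\begin{pmatrix}Q&L'\\L&R\end{pmatrix}$ is symmetric positive definite ($'$ denotes the transpose). Write $X\le Y$ if $Y-X$ is symmetric positive semidefinite and $X\gg0$ if $X$ is symmetric positive definite. For $X$ symmetric and $Y\gg0$ put $M(X/Y)=\inf\{t\in\mathbb R: X\le tY\}$ and $m(X/Y)=\sup\{t\in\mathbb R: tY\le X\}$, and for $X,Y\gg0$ let $d_T(X,Y)=\log\max\{M(X/Y),M(Y/X)\}$ be the Thompson metric. For $P\gg0$ let $$\phi(P)=A'P+PA+C'PC+Q-(B'P+D'PC+L)'(R+D'PD)^{-1}(B'P+D'PC+L).$$ The generalized algebraic Riccati equation (GARE) is $\phi(P)=0$, $R+D'PD\gg0$. Then the GARE has a solution $\bar P\gg0$ if and only if there is $P_0\gg0$ with $\phi(P_0)\le0$. In that case the solution $\bar P\gg0$ is unique, and for every $P\gg0$ the generalized Riccati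 differential equation $\dot X=\phi(X)$, $X(0)=P$, considered on the set of positive definite matrices, has a unique solution $M_t(P)$, defined and positive definite for all $t\ge0$ (every solution on an interval $[0,T)$ is a restriction of it), and there is $\alpha>0$, which may depend on $P$, such that $$d_T(M_t(P),\bar P)\le e^{-\alpha t}\,d_T(P,\bar P)\qquad\text{for all }t\ge0,$$ where, if $P\ne\bar P$, $$\alpha\ \ge\ \frac{1-e^{-d_T(P,\bar P)}}{d_T(P,\bar P)}\;m\big((Q-L'R^{-1}L)/\bar P\big)\ >\ 0 .$$ (For $P=\bar P$ the trajectory is constant.) -/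

import Mathlib

open scoped Matrix

noncomputable section

namespace GenRiccati

/-- The (non-strict) Loewner order `X ≤ Y` on real square matrices: `Y - X` is symmetric positive
semidefinite. -/
def LoewnerLE {n : ℕ} (X Y : Matrix (Fin n) (Fin n) ℝ) : Prop :=
  (Y - X).PosSemidef

/-- `M(X/Y) = inf {t ∈ ℝ : X ≤ t Y}` for the cone of positive semidefinite matrices. -/
def bigM {n : ℕ} (X Y : Matrix (Fin n) (Fin n) ℝ) : ℝ :=
  sInf {t : ℝ | LoewnerLE X (t • Y)}

/-- `m(X/Y) = sup {t ∈ ℝ : X ≥ t Y}` for the cone of positive semidefinite matrices. -/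
def smallM {n : ℕ} (X Y : Matrix (Fin n) (Fin n) ℝ) : ℝ :=
  sSup {t : ℝ | LoewnerLE (t • Y) X}

/-- Thompson's part metric `log max {M(X/Y), M(Y/X)}` (used on positive definite matrices). -/
def dT {n : ℕ} (X Y : Matrix (Fin n) (Fin n) ℝ) : ℝ :=
  Real.log (max (bigM X Y) (bigM Y X))

/-- Constant coefficients of the generalized Riccati equation, state dimension `n`, control
dimension `k`. -/
structure Coeffs (n k : ℕ) where
  A : Matrix (Fin n) (Fin n) ℝ
  B : Matrix (Fin n) (Fin k) ℝ
  C : Matrix (Fin n) (Fin n) ℝ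
  D : Matrix (Fin n) (Fin k) ℝ
  L : Matrix (Fin k) (Fin n) ℝ
  Q : Matrix (Fin n) (Fin n) ℝ
  R : Matrix (Fin k) (Fin k) ℝ

namespace Coeffs

variable {n k : ℕ} (S : Coeffs n k)

/-- The block matrix `[[Q, L'], [L, R]]`. -/
def weight : Matrix (Fin n ⊕ Fin k) (Fin n ⊕ Fin k) ℝ :=
  Matrix.fromBlocks S.Q S.Lᵀ S.L S.R

/-- The right-hand side of the generalized Riccati equation. -/
def phi (P : Matrix (Fin n) (Fin n) ℝ) : Matrix (Fin n) (Fin n) ℝ :=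
  S.Aᵀ * P + P * S.A + S.Cᵀ * P * S.C + S.Q
    - (S.Bᵀ * P + S.Dᵀ * P * S.C + S.L)ᵀ * (S.R + S.Dᵀ * P * S.D)⁻¹
      * (S.Bᵀ * P + S.Dᵀ * P * S.C + S.L)

/-- The generalized algebraic Riccati equation. -/
def GARE (P : Matrix (Fin n) (Fin n) ℝ) : Prop :=
  S.phi P = 0 ∧ (S.R + S.Dᵀ * P * S.D).PosDef

/-- `X` restricted to `[0, T)` is a solution, with values in the positive definite matrices, of the
initial value problem `X' = φ(X)`, `X(0) = P`. At `t = 0` the derivative is the right derivative. -/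
def IsSolution (P : Matrix (Fin n) (Fin n) ℝ) (T : EReal)
    (X : ℝ → Matrix (Fin n) (Fin n) ℝ) : Prop :=
  X 0 = P ∧ ∀ t : ℝ, 0 ≤ t → (t : EReal) < T →
    (X t).PosDef ∧ HasDerivWithinAt X (S.phi (X t)) (Set.Ici 0) t

/-- `X` is the trajectory `t ↦ M_t(P)`, `t ≥ 0`, of the flow on the positive definite matrices:
it solves the initial value problem for all times, and every solution on some `[0, T)` is a
restriction of it. -/
def IsTrajectory (P : Matrix (Fin n) (Fin n) ℝ) (X : ℝ → Matrix (Fin n) (Fin n) ℝ) : Prop :=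
  S.IsSolution P ⊤ X ∧
    ∀ (T : EReal) (Y : ℝ → Matrix (Fin n) (Fin n) ℝ), S.IsSolution P T Y →
      ∀ t : ℝ, 0 ≤ t → (t : EReal) < T → Y t = X t

/-- `((1 - e^{-d}) / d) * m((Q - L' R⁻¹ L) / P̄)` with `d = d_T(P, P̄)`, meaningful for
`P ≠ P̄`. -/
def rate (P Pbar : Matrix (Fin n) (Fin n) ℝ) : ℝ :=
  (1 - Real.exp (-dT P Pbar)) / dT P Pbar * smallM (S.Q - S.Lᵀ * S.R⁻¹ * S.L) Pbar

end Coeffs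

end GenRiccati

end

/-! Completing the square exhibits `φ(P)` as the minimum over feedbacks `K` of the affine operators
`lyap K P + cost K`, attained at `gain P` (`phi_add_square`). Every `cost K` dominates the positive
definite matrix `Q - L'R⁻¹L`, so `φ(aP) ≥ aφ(P) + (1 - a)(Q - L'R⁻¹L)` for `0 ≤ a ≤ 1`, with the
inequality reversed for `a ≥ 1`. Each `lyap K` is quasi-monotone for the Loewner order, whence a
comparison principle (`posSemidef_sub_of_deriv`). It yields uniqueness, invariance of order
intervals and, with a Lipschitz extension of `φ`, global existence.

For the algebraic equation, a small multiple of a supersolution is a subsolution. Among the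
supersolutions between the two, take one of least trace: the flow from it decreases inside this
compact set, so it stands still and is a zero of `φ` (`exists_phi_eq_zero`).

For contraction, with `m = m((Q - L'R⁻¹L)/P̄)`, the curves `exp(±l(t)) P̄` are moving super- and
subsolutions once `-l' ≤ (1 - exp(-l)) m`. For `l = d exp(-αt)`, convexity of `exp` reduces this to
`t = 0`, where equality defines the stated rate (`dT_le_exp_rate`). Strict contraction rules out a
second solution. -/

namespace GenRiccati

open scoped NNReal
open Set Filter Topology

variable {n k : ℕ}

/-! ### Quadratic forms and the Loewner order -/

/-- The quadratic form `v ↦ v' M v`. -/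
def quad {n : ℕ} (M : Matrix (Fin n) (Fin n) ℝ) (v : Fin n → ℝ) : ℝ := v ⬝ᵥ M *ᵥ v

theorem posSemidef_iff_quad {M : Matrix (Fin n) (Fin n) ℝ} :
    M.PosSemidef ↔ Mᵀ = M ∧ ∀ v, 0 ≤ quad M v := by
  rw [Matrix.posSemidef_iff_dotProduct_mulVec]
  simp [Matrix.IsHermitian, quad]

theorem posDef_iff_quad {M : Matrix (Fin n) (Fin n) ℝ} :
    M.PosDef ↔ Mᵀ = M ∧ ∀ v, v ≠ 0 → 0 < quad M v := by
  rw [Matrix.posDef_iff_dotProduct_mulVec]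
  simp [Matrix.IsHermitian, quad]

theorem quad_add (M N : Matrix (Fin n) (Fin n) ℝ) (v : Fin n → ℝ) :
    quad (M + N) v = quad M v + quad N v := by
  simp [quad, Matrix.add_mulVec]

theorem quad_sub (M N : Matrix (Fin n) (Fin n) ℝ) (v : Fin n → ℝ) :
    quad (M - N) v = quad M v - quad N v := by
  simp [quad, Matrix.sub_mulVec]

theorem quad_neg (M : Matrix (Fin n) (Fin n) ℝ) (v : Fin n → ℝ) :
    quad (-M) v = -quad M v := by
  simp [quad, Matrix.neg_mulVec]

theorem quad_smul (a : ℝ) (M : Matrix (Fin n) (Fin n) ℝ) (v : Fin n → ℝ) :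
    quad (a • M) v = a * quad M v := by
  simp [quad, Matrix.smul_mulVec]

theorem quad_one (v : Fin n → ℝ) : quad 1 v = v ⬝ᵥ v := by
  simp [quad]

theorem quad_smul_vec (M : Matrix (Fin n) (Fin n) ℝ) (a : ℝ) (v : Fin n → ℝ) :
    quad M (a • v) = a ^ 2 * quad M v := by
  simp [quad, Matrix.mulVec_smul]; ring

theorem quad_eq_sum (M : Matrix (Fin n) (Fin n) ℝ) (v : Fin n → ℝ) :
    quad M v = ∑ i, ∑ j, v i * (M i j * v j) := by
  simp [quad, dotProduct, Matrix.mulVec, Finset.mul_sum]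

theorem quad_transpose_mul_mul {m : ℕ} (N : Matrix (Fin m) (Fin n) ℝ)
    (M : Matrix (Fin m) (Fin m) ℝ) (v : Fin n → ℝ) :
    quad (Nᵀ * M * N) v = quad M (N *ᵥ v) := by
  simp only [quad, ← Matrix.mulVec_mulVec]
  rw [Matrix.dotProduct_mulVec, Matrix.vecMul_transpose]

theorem dotProduct_self_pos {v : Fin n → ℝ} (hv : v ≠ 0) : 0 < v ⬝ᵥ v := by
  have := Matrix.dotProduct_star_self_pos_iff.2 hv
  simpa using this

/-- The sum of the absolute entries serves throughout as a substitute for the operator norm. -/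
theorem quad_le_sum_abs (M : Matrix (Fin n) (Fin n) ℝ) (v : Fin n → ℝ) :
    quad M v ≤ (∑ i, ∑ j, |M i j|) * (v ⬝ᵥ v) := by
  have hv : ∀ i, |v i| ^ 2 ≤ v ⬝ᵥ v := fun i => by
    rw [sq_abs, sq]
    exact Finset.single_le_sum (f := fun i => v i * v i) (fun i _ => mul_self_nonneg _)
      (Finset.mem_univ i)
  rw [quad_eq_sum, Finset.sum_mul]
  refine Finset.sum_le_sum fun i _ => ?_
  rw [Finset.sum_mul]
  refine Finset.sum_le_sum fun j _ => ?_
  calc v i * (M i j * v j) ≤ |v i * (M i j * v j)| := le_abs_self _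
    _ = |M i j| * (|v i| * |v j|) := by rw [abs_mul, abs_mul]; ring
    _ ≤ |M i j| * (v ⬝ᵥ v) := by
      refine mul_le_mul_of_nonneg_left ?_ (abs_nonneg _)
      nlinarith [hv i, hv j, sq_nonneg (|v i| - |v j|)]

theorem isCompact_unitVectors : IsCompact {v : Fin n → ℝ | v ⬝ᵥ v = 1} := by
  refine Metric.isCompact_of_isClosed_isBounded ?_ ?_
  · exact isClosed_eq (by unfold dotProduct; fun_prop) continuous_const
  · refine (Metric.isBounded_closedBall (x := (0 : Fin n → ℝ)) (r := 1)).subset fun v hv => ?_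
    rw [mem_closedBall_zero_iff, pi_norm_le_iff_of_nonneg zero_le_one]
    intro i
    have h : v i * v i ≤ v ⬝ᵥ v := Finset.single_le_sum (f := fun i => v i * v i)
      (fun i _ => mul_self_nonneg _) (Finset.mem_univ i)
    rw [Set.mem_ofPred_eq] at hv
    rw [Real.norm_eq_abs, abs_le_one_iff_mul_self_le_one]
    linarith

theorem exists_unit_smul {v : Fin n → ℝ} (hv : v ≠ 0) :
    ∃ a : ℝ, 0 < a ∧ ∃ u : Fin n → ℝ, u ⬝ᵥ u = 1 ∧ v = a • u := by
  have h := dotProduct_self_pos hv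
  have hs := Real.sqrt_pos.2 h
  refine ⟨√(v ⬝ᵥ v), hs, (√(v ⬝ᵥ v))⁻¹ • v, ?_, ?_⟩
  · rw [smul_dotProduct, dotProduct_smul, smul_eq_mul, smul_eq_mul, ← mul_assoc, ← mul_inv,
      Real.mul_self_sqrt h.le, inv_mul_cancel₀ h.ne']
  · rw [smul_smul, mul_inv_cancel₀ hs.ne', one_smul]

theorem continuous_quad_prod :
    Continuous fun p : Matrix (Fin n) (Fin n) ℝ × (Fin n → ℝ) => quad p.1 p.2 := by
  unfold quad
  fun_prop

/-- The constant is the minimum over the compact Euclidean unit sphere; for `n = 0` the sphere is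
empty and any constant works. -/
theorem _root_.Matrix.PosDef.exists_pos_mul_le_quad {M : Matrix (Fin n) (Fin n) ℝ}
    (hM : M.PosDef) : ∃ c : ℝ, 0 < c ∧ ∀ v, c * (v ⬝ᵥ v) ≤ quad M v := by
  rw [posDef_iff_quad] at hM
  rcases Set.eq_empty_or_nonempty {v : Fin n → ℝ | v ⬝ᵥ v = 1} with he | hne
  · refine ⟨1, one_pos, fun v => ?_⟩
    by_cases hv : v = 0
    · simp [hv, quad]
    · obtain ⟨a, -, u, hu, -⟩ := exists_unit_smul hv
      exact absurd (show u ∈ {v : Fin n → ℝ | v ⬝ᵥ v = 1} from hu) (by simp [he])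
  · obtain ⟨u, hu, hmin⟩ := isCompact_unitVectors.exists_isMinOn hne
      (f := fun v => quad M v)
      (continuous_quad_prod.comp (Continuous.prodMk_right M)).continuousOn
    have hu0 : u ≠ 0 := by
      rintro rfl
      simp at hu
    refine ⟨quad M u, hM.2 u hu0, fun v => ?_⟩
    by_cases hv : v = 0
    · simp [hv, quad]
    · obtain ⟨a, ha, w, hw, rfl⟩ := exists_unit_smul hv
      have := hmin hw
      rw [quad_smul_vec, smul_dotProduct, dotProduct_smul, hw]
      simp only [smul_eq_mul, Set.mem_ofPred_eq] at *
      nlinarith [sq_nonneg a]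

theorem exists_smul_sub_posSemidef {X Y : Matrix (Fin n) (Fin n) ℝ} (hX : Xᵀ = X)
    (hY : Y.PosDef) : ∃ t : ℝ, 0 < t ∧ (t • Y - X).PosSemidef := by
  obtain ⟨c, hc, hcY⟩ := hY.exists_pos_mul_le_quad
  have hb : 0 ≤ ∑ i, ∑ j, |X i j| := by positivity
  -- The quotient alone dominates `X`; the `+ 1` only makes `t` positive.
  refine ⟨(∑ i, ∑ j, |X i j|) / c + 1, by positivity, posSemidef_iff_quad.2 ⟨?_, fun v => ?_⟩⟩
  · rw [Matrix.transpose_sub, Matrix.transpose_smul, hX, (posDef_iff_quad.1 hY).1]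
  · rw [quad_sub, quad_smul]
    have h1 := quad_le_sum_abs X v
    have h0 : 0 ≤ v ⬝ᵥ v := by simpa using dotProduct_star_self_nonneg v
    have h2 := mul_le_mul_of_nonneg_left (hcY v) (show 0 ≤ (∑ i, ∑ j, |X i j|) / c by positivity)
    rw [← mul_assoc, div_mul_cancel₀ _ hc.ne'] at h2
    nlinarith [hcY v, mul_nonneg hc.le h0]

theorem eq_of_posSemidef_sub {X Y : Matrix (Fin n) (Fin n) ℝ} (h1 : (Y - X).PosSemidef)
    (h2 : (X - Y).PosSemidef) : X = Y := by
  open scoped MatrixOrder in exact le_antisymm (Matrix.le_iff.2 h1) (Matrix.le_iff.2 h2)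

theorem posSemidef_sub_trans {X Y Z : Matrix (Fin n) (Fin n) ℝ} (h1 : (Y - X).PosSemidef)
    (h2 : (Z - Y).PosSemidef) : (Z - X).PosSemidef := by
  have := h2.add h1
  rwa [sub_add_sub_cancel] at this

theorem posDef_of_posSemidef_sub {X Y : Matrix (Fin n) (Fin n) ℝ} (hX : X.PosDef)
    (h : (Y - X).PosSemidef) : Y.PosDef := by
  have := hX.add_posSemidef h
  rwa [add_sub_cancel] at this

theorem mulVec_eq_zero_of_quad_eq_zero {M : Matrix (Fin n) (Fin n) ℝ} (hM : M.PosSemidef)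
    {v : Fin n → ℝ} (hv : quad M v = 0) : M *ᵥ v = 0 :=
  (hM.dotProduct_mulVec_zero_iff v).1 (by simpa [quad] using hv)

/-! ### The Riccati operator as a minimum of affine operators -/

namespace Coeffs

variable (S : Coeffs n k)

/-- The matrix `R + D' P D` inverted in the Riccati equation. -/
def denom (P : Matrix (Fin n) (Fin n) ℝ) : Matrix (Fin k) (Fin k) ℝ := S.R + S.Dᵀ * P * S.D

/-- The matrix `B' P + D' P C + L`. -/
def cross (P : Matrix (Fin n) (Fin n) ℝ) : Matrix (Fin k) (Fin n) ℝ :=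
  S.Bᵀ * P + S.Dᵀ * P * S.C + S.L

/-- The optimal feedback gain `-(R + D' P D)⁻¹ (B' P + D' P C + L)`. -/
noncomputable def gain (P : Matrix (Fin n) (Fin n) ℝ) : Matrix (Fin k) (Fin n) ℝ :=
  -((S.denom P)⁻¹ * S.cross P)

/-- The generalized Lyapunov operator of the system closed by the feedback `K`. -/
def lyap (K : Matrix (Fin k) (Fin n) ℝ) (P : Matrix (Fin n) (Fin n) ℝ) :
    Matrix (Fin n) (Fin n) ℝ :=
  (S.A + S.B * K)ᵀ * P + P * (S.A + S.B * K) + (S.C + S.D * K)ᵀ * P * (S.C + S.D * K)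

/-- The running cost matrix of the feedback `K`. -/
def cost (K : Matrix (Fin k) (Fin n) ℝ) : Matrix (Fin n) (Fin n) ℝ :=
  S.Q + S.Lᵀ * K + Kᵀ * S.L + Kᵀ * S.R * K

/-- The Schur complement `Q - L' R⁻¹ L`. -/
noncomputable def schur : Matrix (Fin n) (Fin n) ℝ := S.Q - S.Lᵀ * S.R⁻¹ * S.L

variable {S}

theorem transpose_Q (hS : S.weight.PosDef) : S.Qᵀ = S.Q := by
  have h : S.weight.IsHermitian := hS.1
  have := Matrix.isHermitian_fromBlocks_iff.1 h
  simpa [Matrix.IsHermitian] using this.1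

theorem transpose_R (hS : S.weight.PosDef) : S.Rᵀ = S.R := by
  have h : S.weight.IsHermitian := hS.1
  have := Matrix.isHermitian_fromBlocks_iff.1 h
  simpa [Matrix.IsHermitian] using this.2.2.2

theorem posDef_R (hS : S.weight.PosDef) : S.R.PosDef :=
  hS.submatrix (e := Sum.inr) Sum.inr_injective

theorem posDef_denom (hS : S.weight.PosDef) {P : Matrix (Fin n) (Fin n) ℝ} (hP : P.PosSemidef) :
    (S.denom P).PosDef :=
  (posDef_R hS).add_posSemidef (by simpa using hP.conjTranspose_mul_mul_same S.D)

/-- The cost is the weight restricted to the graph of `K`, so it inherits positivity. -/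
theorem cost_eq (K : Matrix (Fin k) (Fin n) ℝ) :
    S.cost K = (Matrix.fromRows (1 : Matrix (Fin n) (Fin n) ℝ) K)ᵀ * S.weight *
      Matrix.fromRows (1 : Matrix (Fin n) (Fin n) ℝ) K := by
  rw [weight, Matrix.mul_assoc, Matrix.fromBlocks_mul_fromRows, Matrix.transpose_fromRows,
    Matrix.fromCols_mul_fromRows]
  simp only [cost, Matrix.mul_one, Matrix.transpose_one, Matrix.one_mul, Matrix.mul_add,
    Matrix.mul_assoc]
  abel

theorem posDef_cost (hS : S.weight.PosDef) (K : Matrix (Fin k) (Fin n) ℝ) :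
    (S.cost K).PosDef := by
  rw [cost_eq, ← Matrix.conjTranspose_eq_transpose_of_trivial]
  refine hS.conjTranspose_mul_mul_same fun v w h => ?_
  have := congrArg (fun f => f ∘ Sum.inl) h
  simpa [Matrix.fromRows_mulVec] using this

/-- Used with `G = R` to split the cost and with `G = R + D'PD` to split the Riccati operator. -/
theorem complete_square {G : Matrix (Fin k) (Fin k) ℝ} (hG : G.PosDef)
    (N K : Matrix (Fin k) (Fin n) ℝ) :
    (K + G⁻¹ * N)ᵀ * G * (K + G⁻¹ * N) = Kᵀ * N + Nᵀ * K + Kᵀ * G * K + Nᵀ * G⁻¹ * N := by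
  have hu : IsUnit G.det := (Matrix.isUnit_iff_isUnit_det G).1 hG.isUnit
  have hT : Gᵀ = G := by simpa [Matrix.IsHermitian] using hG.1
  have h1 : G * (K + G⁻¹ * N) = G * K + N := by
    rw [Matrix.mul_add, Matrix.mul_nonsing_inv_cancel_left _ _ hu]
  have h2 : G⁻¹ * (G * K) = K := Matrix.nonsing_inv_mul_cancel_left _ _ hu
  rw [Matrix.mul_assoc, h1, Matrix.transpose_add, Matrix.transpose_mul, Matrix.transpose_nonsing_inv,
    hT]
  simp only [Matrix.add_mul, Matrix.mul_add, Matrix.mul_assoc, h2]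
  abel

theorem schur_eq_cost (hS : S.weight.PosDef) (K : Matrix (Fin k) (Fin n) ℝ) :
    S.cost K = S.schur + (K + S.R⁻¹ * S.L)ᵀ * S.R * (K + S.R⁻¹ * S.L) := by
  rw [complete_square (posDef_R hS), cost, schur]
  abel

theorem posSemidef_cost_sub_schur (hS : S.weight.PosDef) (K : Matrix (Fin k) (Fin n) ℝ) :
    (S.cost K - S.schur).PosSemidef := by
  rw [schur_eq_cost hS, add_sub_cancel_left]
  simpa using (posDef_R hS).posSemidef.conjTranspose_mul_mul_same (K + S.R⁻¹ * S.L)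

/-- The Schur complement is itself a cost matrix, that of `K = -R⁻¹L`. -/
theorem posDef_schur (hS : S.weight.PosDef) : S.schur.PosDef := by
  have h := schur_eq_cost hS (-(S.R⁻¹ * S.L))
  rw [neg_add_cancel, Matrix.mul_zero, add_zero] at h
  exact h ▸ posDef_cost hS _

/-- The square vanishes at `K = gain P`, so `φ` is a minimum of affine operators; its concavity and
order properties rest on this. -/
theorem phi_add_square (hS : S.weight.PosDef) {P : Matrix (Fin n) (Fin n) ℝ} (hP : P.PosSemidef)
    (K : Matrix (Fin k) (Fin n) ℝ) :
    S.lyap K P + S.cost K =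
      S.phi P + (K - S.gain P)ᵀ * S.denom P * (K - S.gain P) := by
  have hT : Pᵀ = P := (posSemidef_iff_quad.1 hP).1
  rw [gain, sub_neg_eq_add, complete_square (posDef_denom hS hP)]
  simp only [lyap, cost, phi, denom, cross, Matrix.transpose_add, Matrix.transpose_mul,
    Matrix.transpose_transpose, Matrix.add_mul, Matrix.mul_add, Matrix.mul_assoc, hT]
  abel

theorem phi_eq_lyap_gain (hS : S.weight.PosDef) {P : Matrix (Fin n) (Fin n) ℝ}
    (hP : P.PosSemidef) : S.phi P = S.lyap (S.gain P) P + S.cost (S.gain P) := by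
  rw [phi_add_square hS hP]
  simp

theorem posSemidef_lyap_add_cost_sub_phi (hS : S.weight.PosDef) {P : Matrix (Fin n) (Fin n) ℝ}
    (hP : P.PosSemidef) (K : Matrix (Fin k) (Fin n) ℝ) :
    (S.lyap K P + S.cost K - S.phi P).PosSemidef := by
  rw [phi_add_square hS hP, add_sub_cancel_left]
  simpa using (posDef_denom hS hP).posSemidef.conjTranspose_mul_mul_same (K - S.gain P)

theorem transpose_phi (hS : S.weight.PosDef) {P : Matrix (Fin n) (Fin n) ℝ} (hP : Pᵀ = P) :
    (S.phi P)ᵀ = S.phi P := by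
  simp only [phi, Matrix.transpose_add, Matrix.transpose_sub, Matrix.transpose_mul, hP,
    Matrix.transpose_transpose, Matrix.transpose_nonsing_inv, transpose_Q hS, transpose_R hS,
    Matrix.mul_assoc]
  abel

theorem lyap_smul (K : Matrix (Fin k) (Fin n) ℝ) (a : ℝ) (P : Matrix (Fin n) (Fin n) ℝ) :
    S.lyap K (a • P) = a • S.lyap K P := by
  simp [lyap, smul_add]

theorem lyap_sub (K : Matrix (Fin k) (Fin n) ℝ) (P P' : Matrix (Fin n) (Fin n) ℝ) :
    S.lyap K (P - P') = S.lyap K P - S.lyap K P' := by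
  simp only [lyap, Matrix.mul_sub, Matrix.sub_mul]
  abel

theorem lyap_add (K : Matrix (Fin k) (Fin n) ℝ) (P P' : Matrix (Fin n) (Fin n) ℝ) :
    S.lyap K (P + P') = S.lyap K P + S.lyap K P' := by
  simp only [lyap, Matrix.mul_add, Matrix.add_mul]
  abel

/-- `φ(λ P) ≥ λ φ(P) + (1 - λ)(Q - L' R⁻¹ L)` for `0 ≤ λ ≤ 1`. -/
theorem posSemidef_phi_smul_sub (hS : S.weight.PosDef) {P : Matrix (Fin n) (Fin n) ℝ}
    (hP : P.PosSemidef) {a : ℝ} (h0 : 0 ≤ a) (h1 : a ≤ 1) :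
    (S.phi (a • P) - (a • S.phi P + (1 - a) • S.schur)).PosSemidef := by
  have h := phi_eq_lyap_gain hS (hP.smul h0)
  set K := S.gain (a • P)
  have := ((posSemidef_lyap_add_cost_sub_phi hS hP K).smul h0).add
    ((posSemidef_cost_sub_schur hS K).smul (sub_nonneg.2 h1))
  convert this using 1
  rw [h, lyap_smul]
  module

/-- `φ(λ P) ≤ λ φ(P) - (λ - 1)(Q - L' R⁻¹ L)` for `1 ≤ λ`. -/
theorem posSemidef_sub_phi_smul (hS : S.weight.PosDef) {P : Matrix (Fin n) (Fin n) ℝ}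
    (hP : P.PosSemidef) {a : ℝ} (h1 : 1 ≤ a) :
    (a • S.phi P - (a - 1) • S.schur - S.phi (a • P)).PosSemidef := by
  have h := phi_eq_lyap_gain hS hP
  set K := S.gain P
  have := (posSemidef_lyap_add_cost_sub_phi hS (hP.smul (zero_le_one.trans h1)) K).add
    ((posSemidef_cost_sub_schur hS K).smul (sub_nonneg.2 h1))
  convert this using 1
  rw [h, lyap_smul]
  module

/-- On the kernel of `Z` the two one-sided products vanish and only a congruence of `Z` remains.
This is the quasi-monotonicity behind the comparison principle. -/
theorem quad_lyap_nonneg (K : Matrix (Fin k) (Fin n) ℝ) {Z : Matrix (Fin n) (Fin n) ℝ}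
    (hZ : Z.PosSemidef) {v : Fin n → ℝ} (hv : Z *ᵥ v = 0) : 0 ≤ quad (S.lyap K Z) v := by
  have hT := (posSemidef_iff_quad.1 hZ).1
  have h1 : quad ((S.A + S.B * K)ᵀ * Z) v = 0 := by
    simp [quad, ← Matrix.mulVec_mulVec, hv]
  have h2 : quad (Z * (S.A + S.B * K)) v = 0 := by
    rw [quad, ← Matrix.mulVec_mulVec, Matrix.dotProduct_mulVec, ← Matrix.mulVec_transpose, hT, hv,
      zero_dotProduct]
  rw [lyap, quad_add, quad_add, h1, h2, quad_transpose_mul_mul, zero_add, zero_add]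
  exact (posSemidef_iff_quad.1 hZ).2 _

end Coeffs

/-! ### Curves of matrices and the comparison principle -/

theorem hasDerivWithinAt_iff_entries {m l : ℕ} {X : ℝ → Matrix (Fin m) (Fin l) ℝ}
    {X' : Matrix (Fin m) (Fin l) ℝ} {s : Set ℝ} {t : ℝ} :
    HasDerivWithinAt X X' s t ↔
      ∀ i j, HasDerivWithinAt (fun t => X t i j) (X' i j) s t := by
  have h1 : HasDerivWithinAt X X' s t ↔
      ∀ i, HasDerivWithinAt (fun t => X t i) (X' i) s t :=
    hasDerivWithinAt_pi (φ := fun t i => X t i) (φ' := fun i => X' i)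
  rw [h1]
  exact forall_congr' fun i => hasDerivWithinAt_pi

theorem hasDerivWithinAt_matrix_const (P : Matrix (Fin n) (Fin n) ℝ) (s : Set ℝ) (t : ℝ) :
    HasDerivWithinAt (fun _ : ℝ => P) 0 s t :=
  hasDerivWithinAt_iff_entries.2 fun i j => hasDerivWithinAt_const t s (P i j)

theorem hasDerivWithinAt_matrix_mono {X : ℝ → Matrix (Fin n) (Fin n) ℝ}
    {X' : Matrix (Fin n) (Fin n) ℝ} {s s' : Set ℝ} {t : ℝ} (h : HasDerivWithinAt X X' s t)
    (hs : s' ⊆ s) : HasDerivWithinAt X X' s' t :=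
  hasDerivWithinAt_iff_entries.2 fun i j => (hasDerivWithinAt_iff_entries.1 h i j).mono hs

theorem hasDerivWithinAt_quad {X : ℝ → Matrix (Fin n) (Fin n) ℝ}
    {X' : Matrix (Fin n) (Fin n) ℝ} {s : Set ℝ} {t : ℝ} (h : HasDerivWithinAt X X' s t)
    (v : Fin n → ℝ) : HasDerivWithinAt (fun t => quad (X t) v) (quad X' v) s t := by
  simp only [quad_eq_sum]
  rw [hasDerivWithinAt_iff_entries] at h
  refine HasDerivWithinAt.fun_sum fun i _ => HasDerivWithinAt.fun_sum fun j _ => ?_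
  exact ((h i j).mul_const (v j)).const_mul (v i)

theorem continuousOn_of_hasDerivWithinAt {X X' : ℝ → Matrix (Fin n) (Fin n) ℝ} {s : Set ℝ}
    (h : ∀ t ∈ s, HasDerivWithinAt X (X' t) s t) : ContinuousOn X s := by
  refine continuousOn_pi.2 fun i => continuousOn_pi.2 fun j t ht => ?_
  exact (hasDerivWithinAt_iff_entries.1 (h t ht) i j).continuousWithinAt

theorem deriv_nonpos_of_left_le {g : ℝ → ℝ} {g' T t : ℝ} (ht0 : 0 < t) (htT : t ≤ T)
    (hd : HasDerivWithinAt g g' (Icc 0 T) t) (h : ∀ s ∈ Ico 0 t, g t ≤ g s) : g' ≤ 0 := by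
  have hd' := hd.mono (show Ico 0 t ⊆ Icc 0 T from fun s hs => ⟨hs.1, hs.2.le.trans htT⟩)
  rw [hasDerivWithinAt_iff_tendsto_slope' (by simp)] at hd'
  have : (𝓝[Ico 0 t] t).NeBot := by
    rw [nhdsWithin_Ico_eq_nhdsLT ht0]
    infer_instance
  refine le_of_tendsto hd' (eventually_nhdsWithin_of_forall fun s hs => ?_)
  rw [slope_def_field]
  exact div_nonpos_of_nonneg_of_nonpos (by linarith [h s hs]) (by linarith [hs.2])

/-- A curve of symmetric matrices stays positive definite if its derivative points strictly
inwards at the boundary of the cone. -/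
theorem posDef_of_deriv_pos_on_ker {T : ℝ} {Z Z' : ℝ → Matrix (Fin n) (Fin n) ℝ}
    (hsymm : ∀ t ∈ Icc 0 T, (Z t)ᵀ = Z t) (h0 : (Z 0).PosDef)
    (hd : ∀ t ∈ Icc 0 T, HasDerivWithinAt Z (Z' t) (Icc 0 T) t)
    (hpos : ∀ t ∈ Icc 0 T, (Z t).PosSemidef → ∀ v, v ≠ 0 → Z t *ᵥ v = 0 → 0 < quad (Z' t) v) :
    ∀ t ∈ Icc 0 T, (Z t).PosDef := by
  have hcont := continuousOn_of_hasDerivWithinAt hd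
  set f : ℝ × (Fin n → ℝ) → ℝ := fun p => quad (Z p.1) p.2
  have hf : ContinuousOn f (Icc 0 T ×ˢ {v : Fin n → ℝ | v ⬝ᵥ v = 1}) :=
    continuous_quad_prod.comp_continuousOn
      ((hcont.comp continuousOn_fst fun p hp => hp.1).prodMk continuousOn_snd)
  have hcpt : IsCompact (Icc 0 T ×ˢ {v : Fin n → ℝ | v ⬝ᵥ v = 1}) :=
    isCompact_Icc.prod isCompact_unitVectors
  -- Pairs of a time and a unit vector at which positivity fails; a pair of least time marks the
  -- first exit from the cone.
  have hC : IsCompact ((Icc 0 T ×ˢ {v : Fin n → ℝ | v ⬝ᵥ v = 1}) ∩ f ⁻¹' Iic 0) :=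
    hcpt.of_isClosed_subset (hf.preimage_isClosed_of_isClosed hcpt.isClosed isClosed_Iic)
      inter_subset_left
  have hkey : ∀ t ∈ Icc 0 T, (∀ u : Fin n → ℝ, u ⬝ᵥ u = 1 → 0 < f (t, u)) → (Z t).PosDef := by
    intro t ht h
    refine posDef_iff_quad.2 ⟨hsymm t ht, fun v hv => ?_⟩
    obtain ⟨a, ha, u, hu, rfl⟩ := exists_unit_smul hv
    rw [quad_smul_vec]
    exact mul_pos (by positivity) (h u hu)
  rcases Set.eq_empty_or_nonempty
    ((Icc 0 T ×ˢ {v : Fin n → ℝ | v ⬝ᵥ v = 1}) ∩ f ⁻¹' Iic 0) with he | hne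
  · intro t ht
    refine hkey t ht fun u hu => ?_
    by_contra hcon
    exact notMem_empty (t, u) (he.subset ⟨⟨ht, hu⟩, not_lt.1 hcon⟩)
  · exfalso
    obtain ⟨⟨t, v⟩, ⟨⟨ht, hv⟩, hle⟩, hmin⟩ := hC.exists_isMinOn hne continuous_fst.continuousOn
    simp only [mem_preimage, mem_Iic, f] at hle ht hv
    have hv0 : v ≠ 0 := by
      rintro rfl
      simp at hv
    have hbefore : ∀ s ∈ Ico 0 t, (Z s).PosDef := fun s hs => by
      have hsT : s ∈ Icc 0 T := ⟨hs.1, hs.2.le.trans ht.2⟩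
      refine hkey s hsT fun u hu => ?_
      by_contra hcon
      have : t ≤ s := hmin (show (s, u) ∈ _ from ⟨⟨hsT, hu⟩, not_lt.1 hcon⟩)
      exact absurd hs.2 (not_lt.2 this)
    have htpos : 0 < t := by
      refine lt_of_le_of_ne ht.1 fun h => ?_
      subst h
      exact absurd ((posDef_iff_quad.1 h0).2 v hv0) (not_lt.2 hle)
    have hne' : (𝓝[Ico 0 t] t).NeBot := by
      rw [nhdsWithin_Ico_eq_nhdsLT htpos]
      infer_instance
    have hpsd : (Z t).PosSemidef := by
      refine posSemidef_iff_quad.2 ⟨hsymm t ht, fun w => ?_⟩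
      have hw := ((hasDerivWithinAt_quad (hd t ht) w).continuousWithinAt).mono
        (show Ico 0 t ⊆ Icc 0 T from fun s hs => ⟨hs.1, hs.2.le.trans ht.2⟩)
      exact ge_of_tendsto hw (eventually_nhdsWithin_of_forall fun s hs =>
        (posSemidef_iff_quad.1 (hbefore s hs).posSemidef).2 w)
    have hzero : quad (Z t) v = 0 := le_antisymm hle ((posSemidef_iff_quad.1 hpsd).2 v)
    -- Along `v` the form is nonnegative before `t` and zero at `t`, although `v` lies in the
    -- kernel, where `hpos` demands a positive derivative.
    have hd0 : quad (Z' t) v ≤ 0 :=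
      deriv_nonpos_of_left_le htpos ht.2 (hasDerivWithinAt_quad (hd t ht) v) fun s hs =>
        hle.trans ((posSemidef_iff_quad.1 (hbefore s hs).posSemidef).2 v)
    exact absurd (hpos t ht hpsd v hv0 (mulVec_eq_zero_of_quad_eq_zero hpsd hzero))
      (not_lt.2 hd0)

theorem continuous_matrix_inv {X : Type*} [TopologicalSpace X] {M : X → Matrix (Fin k) (Fin k) ℝ}
    (hM : Continuous M) (hdet : ∀ x, (M x).det ≠ 0) : Continuous fun x => (M x)⁻¹ := by
  simp only [Matrix.inv_def, Ring.inverse_eq_inv']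
  exact (hM.matrix_det.inv₀ hdet).smul hM.matrix_adjugate

namespace Coeffs

variable {S : Coeffs n k}

theorem det_denom_ne_zero (hS : S.weight.PosDef) {P : Matrix (Fin n) (Fin n) ℝ}
    (hP : P.PosSemidef) : (S.denom P).det ≠ 0 :=
  ((Matrix.isUnit_iff_isUnit_det _).1 (posDef_denom hS hP).isUnit).ne_zero

theorem continuous_gain (hS : S.weight.PosDef) {X : Type*} [TopologicalSpace X]
    {U : X → Matrix (Fin n) (Fin n) ℝ} (hU : Continuous U) (hpsd : ∀ x, (U x).PosSemidef) :
    Continuous fun x => S.gain (U x) := by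
  have h1 : Continuous fun x => (S.denom (U x))⁻¹ := by
    refine continuous_matrix_inv ?_ fun x => det_denom_ne_zero hS (hpsd x)
    unfold denom
    fun_prop
  unfold gain cross
  fun_prop

/-- Comparison principle for the generalized Riccati differential equation. -/
theorem posSemidef_sub_of_deriv (hS : S.weight.PosDef) {T : ℝ}
    {U U' V V' : ℝ → Matrix (Fin n) (Fin n) ℝ}
    (hU : ∀ t ∈ Icc 0 T, (U t).PosSemidef) (hV : ∀ t ∈ Icc 0 T, (V t).PosSemidef)
    (hUd : ∀ t ∈ Icc 0 T, HasDerivWithinAt U (U' t) (Icc 0 T) t)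
    (hVd : ∀ t ∈ Icc 0 T, HasDerivWithinAt V (V' t) (Icc 0 T) t)
    (hle : ∀ t ∈ Icc 0 T, ((U' t - S.phi (U t)) - (V' t - S.phi (V t))).PosSemidef)
    (h0 : (U 0 - V 0).PosSemidef) :
    ∀ t ∈ Icc 0 T, (U t - V t).PosSemidef := by
  -- `c` bounds the effect of the closed-loop Lyapunov operators on the identity perturbation added
  -- below.
  obtain ⟨c, hc⟩ : ∃ c : ℝ, ∀ t ∈ Icc 0 T, ∑ i, ∑ j, |S.lyap (S.gain (U t)) 1 i j| ≤ c := by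
    have hcont : ContinuousOn (fun t => ∑ i, ∑ j, |S.lyap (S.gain (U t)) 1 i j|) (Icc 0 T) := by
      rw [continuousOn_iff_continuous_domRestrict]
      have hg : Continuous fun t : Icc 0 T => S.gain (U t) :=
        continuous_gain hS (continuousOn_iff_continuous_domRestrict.1
          (continuousOn_of_hasDerivWithinAt hUd)) fun t => hU t t.2
      have hl : Continuous fun t : Icc 0 T => S.lyap (S.gain (U t)) 1 := by
        unfold lyap
        fun_prop
      exact continuous_finsetSum _ fun i _ => continuous_finsetSum _ fun j _ =>
        (hl.matrix_elem i j).abs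
    obtain ⟨c, hc⟩ := isCompact_Icc.bddAbove_image hcont
    exact ⟨c, fun t ht => hc (mem_image_of_mem _ ht)⟩
  have hsymm : ∀ t ∈ Icc 0 T, (U t - V t)ᵀ = U t - V t := fun t ht => by
    rw [Matrix.transpose_sub, (posSemidef_iff_quad.1 (hU t ht)).1,
      (posSemidef_iff_quad.1 (hV t ht)).1]
  -- The growth rate `c + 1` beats `c`, which makes the derivative strictly inward on the boundary.
  have main : ∀ ε : ℝ, 0 < ε → ∀ t ∈ Icc 0 T,
      (U t - V t + (ε * Real.exp ((c + 1) * t)) • (1 : Matrix (Fin n) (Fin n) ℝ)).PosDef := by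
    intro ε hε
    refine posDef_of_deriv_pos_on_ker (Z' := fun t => U' t - V' t +
      (ε * (Real.exp ((c + 1) * t) * (c + 1))) • (1 : Matrix (Fin n) (Fin n) ℝ)) ?_ ?_ ?_ ?_
    · intro t ht
      rw [Matrix.transpose_add, hsymm t ht, Matrix.transpose_smul, Matrix.transpose_one]
    · refine Matrix.PosDef.posSemidef_add h0 (Matrix.PosDef.one.smul ?_)
      positivity
    · intro t ht
      rw [hasDerivWithinAt_iff_entries]
      intro i j
      have h1 := hasDerivWithinAt_iff_entries.1 (hUd t ht) i j
      have h2 := hasDerivWithinAt_iff_entries.1 (hVd t ht) i j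
      have h3 : HasDerivWithinAt (fun t => Real.exp ((c + 1) * t))
          (Real.exp ((c + 1) * t) * (c + 1)) (Icc 0 T) t := by
        have := ((hasDerivAt_id t).const_mul (c + 1)).exp
        simpa using this.hasDerivWithinAt
      exact (h1.sub h2).add ((h3.const_mul ε).mul_const _)
    · intro t ht hpsd v hv hker
      -- The gain of `U` is optimal for `U` and merely admissible for `V`, so `φ(U) - φ(V) ≥ lyap K
      -- (U - V)`.
      set K := S.gain (U t)
      set e := ε * Real.exp ((c + 1) * t) with he
      have hepos : 0 < e := by positivity
      have hvv := dotProduct_self_pos hv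
      have a1 := (posSemidef_iff_quad.1 (hle t ht)).2 v
      have a2 := (posSemidef_iff_quad.1 (posSemidef_lyap_add_cost_sub_phi hS (hV t ht) K)).2 v
      have a3 : quad (S.phi (U t)) v = quad (S.lyap K (U t)) v + quad (S.cost K) v := by
        rw [phi_eq_lyap_gain hS (hU t ht), quad_add]
      have a4 := quad_lyap_nonneg (S := S) K hpsd hker
      have a5 := (quad_le_sum_abs (S.lyap K 1) v).trans
        (mul_le_mul_of_nonneg_right (hc t ht) hvv.le)
      rw [lyap_add, lyap_sub, lyap_smul] at a4
      simp only [quad_add, quad_sub, quad_smul, quad_one] at *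
      have a6 := mul_le_mul_of_nonneg_left a5 hepos.le
      have a7 := mul_pos hepos hvv
      have a8 : ε * (Real.exp ((c + 1) * t) * (c + 1)) * v ⬝ᵥ v =
          e * (c * v ⬝ᵥ v) + e * v ⬝ᵥ v := by
        rw [he]; ring
      linarith
  intro t ht
  refine posSemidef_iff_quad.2 ⟨hsymm t ht, fun v => ?_⟩
  by_cases hv : v = 0
  · simp [hv, quad]
  have hvv := dotProduct_self_pos hv
  refine le_of_forall_pos_le_add fun δ hδ => ?_
  have hE := Real.exp_pos ((c + 1) * t)
  -- This `ε` makes the perturbation contribute exactly `δ` at the vector `v`.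
  have := (posDef_iff_quad.1 (main (δ / (Real.exp ((c + 1) * t) * v ⬝ᵥ v)) (by positivity) t ht)).2
    v hv
  rw [quad_add, quad_smul, quad_one] at this
  have h2 : δ / (Real.exp ((c + 1) * t) * v ⬝ᵥ v) * Real.exp ((c + 1) * t) * v ⬝ᵥ v = δ := by
    field_simp
  linarith

end Coeffs

/-! ### Lipschitz extension of the vector field -/

/-- The global bound confines curves to a ball of radius `L * T`, so Picard–Lindelöf needs no
shorter interval. -/
theorem exists_integralCurve_Icc {E : Type*} [NormedAddCommGroup E] [NormedSpace ℝ E]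
    [CompleteSpace E] {f : E → E} {K L : ℝ≥0} (hf : LipschitzWith K f) (hb : ∀ x, ‖f x‖ ≤ L)
    (x₀ : E) {T : ℝ} (hT : 0 ≤ T) :
    ∃ α : ℝ → E, α 0 = x₀ ∧ ∀ t ∈ Icc 0 T, HasDerivWithinAt α (f (α t)) (Icc 0 T) t := by
  have h : IsPicardLindelof (fun _ => f) (⟨0, left_mem_Icc.2 hT⟩ : Icc 0 T) x₀
      (L * T.toNNReal) 0 L K :=
    { lipschitzOnWith := fun t _ => hf.lipschitzOnWith
      continuousOn := fun x _ => continuousOn_const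
      norm_le := fun t _ x _ => hb x
      mul_max_le := by simp [hT] }
  exact h.exists_eq_forall_mem_Icc_hasDerivWithinAt₀

/-- Extend first, then truncate to `[-c, c]`, which changes nothing on `N`. -/
theorem exists_bounded_lipschitz_extension {α : Type*} [PseudoMetricSpace α] {N : Set α}
    {f : α → ℝ} {K : ℝ≥0} (hf : LipschitzOnWith K f N) {c : ℝ} (hc : 0 ≤ c)
    (hb : ∀ x ∈ N, |f x| ≤ c) :
    ∃ g : α → ℝ, LipschitzWith K g ∧ (∀ x, |g x| ≤ c) ∧ EqOn f g N := by
  obtain ⟨g, hg, hfg⟩ := hf.extend_real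
  refine ⟨fun x => max (-c) (min c (g x)), (hg.const_min c).const_max (-c), fun x => ?_,
    fun x hx => ?_⟩
  · exact abs_le.2 ⟨le_max_left _ _, max_le (by linarith) (min_le_left _ _)⟩
  · have := abs_le.1 (hb x hx)
    rw [hfg hx] at this
    simp only [hfg hx, min_eq_right this.2, max_eq_right this.1]

section Smooth

variable {E : Type*} [NormedAddCommGroup E] [NormedSpace ℝ E] {s : Set E}

theorem contDiffOn_mul_entries {l m p : ℕ} {M : E → Matrix (Fin l) (Fin m) ℝ}
    {N : E → Matrix (Fin m) (Fin p) ℝ} (hM : ∀ i j, ContDiffOn ℝ 1 (fun x => M x i j) s)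
    (hN : ∀ i j, ContDiffOn ℝ 1 (fun x => N x i j) s) (i : Fin l) (j : Fin p) :
    ContDiffOn ℝ 1 (fun x => (M x * N x) i j) s := by
  simp only [Matrix.mul_apply]
  exact ContDiffOn.sum fun r _ => (hM i r).mul (hN r j)

theorem contDiffOn_det {m : ℕ} {M : E → Matrix (Fin m) (Fin m) ℝ}
    (hM : ∀ i j, ContDiffOn ℝ 1 (fun x => M x i j) s) :
    ContDiffOn ℝ 1 (fun x => (M x).det) s := by
  simp only [Matrix.det_apply]
  exact ContDiffOn.sum fun σ _ => (contDiffOn_prod fun i _ => hM _ _).const_smul _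

/-- By Cramer's rule the entries are quotients of determinants. -/
theorem contDiffOn_inv_entries {m : ℕ} {M : E → Matrix (Fin m) (Fin m) ℝ}
    (hM : ∀ i j, ContDiffOn ℝ 1 (fun x => M x i j) s) (hdet : ∀ x ∈ s, (M x).det ≠ 0)
    (i j : Fin m) : ContDiffOn ℝ 1 (fun x => (M x)⁻¹ i j) s := by
  simp only [Matrix.inv_def, Ring.inverse_eq_inv', Matrix.smul_apply, smul_eq_mul,
    Matrix.adjugate_apply]
  refine ((contDiffOn_det hM).inv hdet).mul (contDiffOn_det fun a b => ?_)
  by_cases h : a = j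
  · subst h
    simpa using contDiffOn_const
  · simpa [Matrix.updateRow_ne h] using hM a b

end Smooth

/-- The symmetric matrices `X` with `c I ≤ X ≤ C I`. -/
def symmBox (n : ℕ) (c C : ℝ) : Set (Fin n → Fin n → ℝ) :=
  {X | (∀ i j, X i j = X j i) ∧
    ∀ v, c * (v ⬝ᵥ v) ≤ quad (Matrix.of X) v ∧ quad (Matrix.of X) v ≤ C * (v ⬝ᵥ v)}

theorem continuous_quad_of (v : Fin n → ℝ) :
    Continuous fun X : Fin n → Fin n → ℝ => quad (Matrix.of X) v := by
  simp only [quad_eq_sum, Matrix.of_apply]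
  fun_prop

theorem isClosed_symmBox (c C : ℝ) : IsClosed (symmBox n c C) := by
  simp only [symmBox, ofPred_and, ofPred_forall]
  refine (isClosed_iInter fun i => isClosed_iInter fun j => isClosed_eq ?_ ?_).inter
    (isClosed_iInter fun v => (isClosed_le continuous_const (continuous_quad_of v)).inter
      (isClosed_le (continuous_quad_of v) continuous_const)) <;> fun_prop

theorem convex_symmBox (c C : ℝ) : Convex ℝ (symmBox n c C) := by
  intro X hX Y hY a b ha hb hab
  have h : ∀ v, quad (Matrix.of (a • X + b • Y)) v =
      a * quad (Matrix.of X) v + b * quad (Matrix.of Y) v := fun v => by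
    rw [← quad_smul, ← quad_smul, ← quad_add]
    rfl
  refine ⟨fun i j => ?_, fun v => ?_⟩
  · simp [hX.1 i j, hY.1 i j]
  · rw [h]
    have h1 := hX.2 v
    have h2 := hY.2 v
    constructor
    · calc c * (v ⬝ᵥ v) = a * (c * (v ⬝ᵥ v)) + b * (c * (v ⬝ᵥ v)) := by
            rw [← add_mul, hab, one_mul]
        _ ≤ _ := add_le_add (mul_le_mul_of_nonneg_left h1.1 ha) (mul_le_mul_of_nonneg_left h2.1 hb)
    · calc _ ≤ a * (C * (v ⬝ᵥ v)) + b * (C * (v ⬝ᵥ v)) :=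
            add_le_add (mul_le_mul_of_nonneg_left h1.2 ha) (mul_le_mul_of_nonneg_left h2.2 hb)
        _ = C * (v ⬝ᵥ v) := by rw [← add_mul, hab, one_mul]

theorem quad_add_vec {M : Matrix (Fin n) (Fin n) ℝ} (hM : Mᵀ = M) (v w : Fin n → ℝ) :
    quad M (v + w) = quad M v + quad M w + 2 * (v ⬝ᵥ M *ᵥ w) := by
  have : w ⬝ᵥ M *ᵥ v = v ⬝ᵥ M *ᵥ w := by
    rw [Matrix.dotProduct_mulVec, ← Matrix.mulVec_transpose, hM, dotProduct_comm]
  simp only [quad, Matrix.mulVec_add, dotProduct_add, add_dotProduct, this]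
  ring

/-- Nonnegativity of the form at `e_i ± e_j` bounds `|X i j|` by the mean of `X i i` and `X j j`,
hence by `C`. -/
theorem isCompact_symmBox {c : ℝ} (hc : 0 ≤ c) (C : ℝ) : IsCompact (symmBox n c C) := by
  refine Metric.isCompact_of_isClosed_isBounded (isClosed_symmBox c C) ?_
  refine (Metric.isBounded_closedBall (x := (0 : Fin n → Fin n → ℝ)) (r := |C|)).subset
    fun X hX => ?_
  rw [mem_closedBall_zero_iff, pi_norm_le_iff_of_nonneg (abs_nonneg _)]
  intro i
  rw [pi_norm_le_iff_of_nonneg (abs_nonneg _)]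
  intro j
  have hT : (Matrix.of X)ᵀ = Matrix.of X := by
    ext a b
    exact hX.1 b a
  have hij : (Pi.single i 1 : Fin n → ℝ) ⬝ᵥ Matrix.of X *ᵥ Pi.single j 1 = X i j := by simp
  have hsq : ∀ l : Fin n, (Pi.single l 1 : Fin n → ℝ) ⬝ᵥ Pi.single l 1 = 1 := fun l => by simp
  have hi := (hX.2 (Pi.single i 1)).2
  have hj := (hX.2 (Pi.single j 1)).2
  have hC := le_abs_self C
  have hp := (hX.2 (Pi.single i 1 + Pi.single j 1)).1
  have hm := (hX.2 (Pi.single i 1 + (-1 : ℝ) • Pi.single j 1)).1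
  have nn : ∀ v : Fin n → ℝ, 0 ≤ c * (v ⬝ᵥ v) := fun v => by
    have : 0 ≤ v ⬝ᵥ v := by simpa using dotProduct_star_self_nonneg v
    positivity
  rw [quad_add_vec hT, hij] at hp
  rw [quad_add_vec hT, Matrix.mulVec_smul, dotProduct_smul, hij, quad_smul_vec, smul_eq_mul] at hm
  have np := (nn _).trans hp
  have nm := (nn _).trans hm
  rw [hsq] at hi hj
  rw [Real.norm_eq_abs, abs_le]
  constructor <;> linarith

namespace Coeffs

variable {S : Coeffs n k}

theorem posSemidef_of_mem_symmBox {c C : ℝ} (hc : 0 ≤ c) {X : Fin n → Fin n → ℝ}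
    (hX : X ∈ symmBox n c C) : (Matrix.of X).PosSemidef := by
  refine posSemidef_iff_quad.2 ⟨?_, fun v => le_trans ?_ (hX.2 v).1⟩
  · ext a b
    exact hX.1 b a
  · have : 0 ≤ v ⬝ᵥ v := by simpa using dotProduct_star_self_nonneg v
    positivity

theorem contDiffOn_phi_entries (hS : S.weight.PosDef) {c : ℝ} (hc : 0 ≤ c) (C : ℝ)
    (i j : Fin n) :
    ContDiffOn ℝ 1 (fun X : Fin n → Fin n → ℝ => S.phi (Matrix.of X) i j) (symmBox n c C) := by
  have hX : ∀ a b, ContDiffOn ℝ 1 (fun X : Fin n → Fin n → ℝ => Matrix.of X a b)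
      (symmBox n c C) := fun a b => by
    simp only [Matrix.of_apply]
    fun_prop
  have hconst : ∀ {l m : ℕ} (M : Matrix (Fin l) (Fin m) ℝ) (a : Fin l) (b : Fin m),
      ContDiffOn ℝ 1 (fun _ : Fin n → Fin n → ℝ => M a b) (symmBox n c C) :=
    fun M a b => contDiffOn_const
  have hcross : ∀ a b, ContDiffOn ℝ 1 (fun X : Fin n → Fin n → ℝ =>
      (S.Bᵀ * Matrix.of X + S.Dᵀ * Matrix.of X * S.C + S.L) a b) (symmBox n c C) := fun a b =>
    ((contDiffOn_mul_entries (hconst _) hX a b).add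
      (contDiffOn_mul_entries (contDiffOn_mul_entries (hconst _) hX) (hconst _) a b)).add
      (hconst _ a b)
  have hden : ∀ a b, ContDiffOn ℝ 1 (fun X : Fin n → Fin n → ℝ =>
      (S.R + S.Dᵀ * Matrix.of X * S.D) a b) (symmBox n c C) := fun a b =>
    (hconst _ a b).add
      (contDiffOn_mul_entries (contDiffOn_mul_entries (hconst _) hX) (hconst _) a b)
  have hinv := contDiffOn_inv_entries hden fun X hX =>
    det_denom_ne_zero hS (posSemidef_of_mem_symmBox hc hX)
  exact ((((contDiffOn_mul_entries (hconst _) hX i j).add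
    (contDiffOn_mul_entries hX (hconst _) i j)).add
      (contDiffOn_mul_entries (contDiffOn_mul_entries (hconst _) hX) (hconst _) i j)).add
      (hconst _ i j)).sub
    (contDiffOn_mul_entries (contDiffOn_mul_entries (fun a b => hcross b a) hinv) hcross i j)

/-- The Riccati vector field on a box of symmetric matrices extends to a bounded Lipschitz field of
symmetric matrices. -/
theorem exists_lipschitz_extension_phi (hS : S.weight.PosDef) {c : ℝ} (hc : 0 ≤ c) (C : ℝ) :
    ∃ (ψ : (Fin n → Fin n → ℝ) → Fin n → Fin n → ℝ) (K L : ℝ≥0), LipschitzWith K ψ ∧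
      (∀ X, ‖ψ X‖ ≤ L) ∧ (∀ X i j, ψ X i j = ψ X j i) ∧
      ∀ X ∈ symmBox n c C, ψ X = S.phi (Matrix.of X) := by
  have key : ∀ i j, ∃ (K : ℝ≥0) (b : ℝ≥0) (g : (Fin n → Fin n → ℝ) → ℝ), LipschitzWith K g ∧
      (∀ X, |g X| ≤ b) ∧
      EqOn (fun X : Fin n → Fin n → ℝ => S.phi (Matrix.of X) i j) g (symmBox n c C) := by
    intro i j
    have hcd := contDiffOn_phi_entries hS hc C i j
    obtain ⟨K, hK⟩ := hcd.exists_lipschitzOnWith one_ne_zero (convex_symmBox c C)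
      (isCompact_symmBox hc C)
    obtain ⟨b, hb⟩ := (isCompact_symmBox hc C).bddAbove_image hcd.continuousOn.abs
    obtain ⟨g, hg⟩ := exists_bounded_lipschitz_extension hK (c := b.toNNReal) (by positivity)
      fun X hX => (hb (mem_image_of_mem _ hX)).trans (Real.le_coe_toNNReal b)
    exact ⟨K, _, g, hg⟩
  choose K b g hg hgb hgeq using key
  have hKle : ∀ i j, K i j ≤ ∑ i, ∑ j, K i j := fun i j =>
    (Finset.single_le_sum (f := fun j => K i j) (fun _ _ => zero_le) (Finset.mem_univ j)).trans
      (Finset.single_le_sum (f := fun i => ∑ j, K i j) (fun _ _ => zero_le) (Finset.mem_univ i))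
  have hble : ∀ i j, b i j ≤ ∑ i, ∑ j, b i j := fun i j =>
    (Finset.single_le_sum (f := fun j => b i j) (fun _ _ => zero_le) (Finset.mem_univ j)).trans
      (Finset.single_le_sum (f := fun i => ∑ j, b i j) (fun _ _ => zero_le) (Finset.mem_univ i))
  -- Averaging with the transpose keeps integral curves symmetric; on the box it changes nothing,
  -- since `φ` is already symmetric there.
  refine ⟨fun X i j => (g i j X + g j i X) / 2, ∑ i, ∑ j, K i j, ∑ i, ∑ j, b i j, ?_, ?_, ?_, ?_⟩
  · have hl : ∀ i j X Y, |g i j X - g i j Y| ≤ ((∑ i, ∑ j, K i j : ℝ≥0) : ℝ) * dist X Y :=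
      fun i j X Y => by
        rw [← Real.dist_eq]
        exact ((hg i j).dist_le_mul X Y).trans
          (mul_le_mul_of_nonneg_right (NNReal.coe_le_coe.2 (hKle i j)) dist_nonneg)
    refine LipschitzWith.of_dist_le_mul fun X Y => ?_
    rw [dist_pi_le_iff (by positivity)]
    intro i
    rw [dist_pi_le_iff (by positivity)]
    intro j
    rw [Real.dist_eq, abs_le]
    have h1 := abs_le.1 (hl i j X Y)
    have h2 := abs_le.1 (hl j i X Y)
    constructor <;> linarith
  · intro X
    rw [pi_norm_le_iff_of_nonneg (NNReal.coe_nonneg _)]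
    intro i
    rw [pi_norm_le_iff_of_nonneg (NNReal.coe_nonneg _)]
    intro j
    rw [Real.norm_eq_abs, abs_le]
    have h1 := abs_le.1 ((hgb i j X).trans (NNReal.coe_le_coe.2 (hble i j)))
    have h2 := abs_le.1 ((hgb j i X).trans (NNReal.coe_le_coe.2 (hble j i)))
    constructor <;> linarith
  · intro X i j
    simp only [add_comm]
  · intro X hX
    have hT : (Matrix.of X)ᵀ = Matrix.of X := by
      ext a b
      exact hX.1 b a
    funext i j
    have h1 : S.phi (Matrix.of X) j i = S.phi (Matrix.of X) i j :=
      congrFun (congrFun (transpose_phi hS hT) i) j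
    have h2 : S.phi (Matrix.of X) i j = g i j X := hgeq i j hX
    have h3 : S.phi (Matrix.of X) j i = g j i X := hgeq j i hX
    change (g i j X + g j i X) / 2 = S.phi (Matrix.of X) i j
    linarith

/-! ### Uniqueness and global existence for the differential equation -/

/-- Comparison in both directions, then antisymmetry of the Loewner order. -/
theorem eq_of_hasDerivWithinAt_phi (hS : S.weight.PosDef) {T : ℝ}
    {X Y : ℝ → Matrix (Fin n) (Fin n) ℝ} (hX : ∀ t ∈ Icc 0 T, (X t).PosSemidef)
    (hY : ∀ t ∈ Icc 0 T, (Y t).PosSemidef)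
    (hXd : ∀ t ∈ Icc 0 T, HasDerivWithinAt X (S.phi (X t)) (Icc 0 T) t)
    (hYd : ∀ t ∈ Icc 0 T, HasDerivWithinAt Y (S.phi (Y t)) (Icc 0 T) t) (h0 : X 0 = Y 0) :
    ∀ t ∈ Icc 0 T, X t = Y t := by
  intro t ht
  refine eq_of_posSemidef_sub
    (posSemidef_sub_of_deriv hS hY hX hYd hXd (fun s _ => ?_) ?_ t ht)
    (posSemidef_sub_of_deriv hS hX hY hXd hYd (fun s _ => ?_) ?_ t ht)
  · simpa using Matrix.PosSemidef.zero
  · simpa [h0] using Matrix.PosSemidef.zero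
  · simpa using Matrix.PosSemidef.zero
  · simpa [h0] using Matrix.PosSemidef.zero

/-- A solution starting between an equilibrium subsolution and supersolution stays there. -/
theorem posSemidef_sub_of_phi_sign (hS : S.weight.PosDef) {T : ℝ}
    {P₁ P₂ : Matrix (Fin n) (Fin n) ℝ} {X : ℝ → Matrix (Fin n) (Fin n) ℝ}
    (h₁ : P₁.PosSemidef) (h₂ : P₂.PosSemidef) (hφ₁ : (S.phi P₁).PosSemidef)
    (hφ₂ : (-S.phi P₂).PosSemidef) (hX : ∀ t ∈ Icc 0 T, (X t).PosSemidef)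
    (hXd : ∀ t ∈ Icc 0 T, HasDerivWithinAt X (S.phi (X t)) (Icc 0 T) t)
    (h01 : (X 0 - P₁).PosSemidef) (h02 : (P₂ - X 0).PosSemidef) :
    ∀ t ∈ Icc 0 T, (X t - P₁).PosSemidef ∧ (P₂ - X t).PosSemidef := by
  have hc : ∀ P : Matrix (Fin n) (Fin n) ℝ, ∀ t ∈ Icc 0 T,
      HasDerivWithinAt (fun _ : ℝ => P) 0 (Icc 0 T) t := fun P t _ => hasDerivWithinAt_matrix_const P _ t
  intro t ht
  constructor
  · refine posSemidef_sub_of_deriv hS hX (fun _ _ => h₁) hXd (hc P₁) (fun s _ => ?_) h01 t ht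
    simpa using hφ₁
  · refine posSemidef_sub_of_deriv hS (fun _ _ => h₂) hX (hc P₂) hXd (fun s _ => ?_) h02 t ht
    simpa using hφ₂

/-- Solve the extended field. While the curve is in the box it solves the Riccati equation, so
comparison confines it to the order interval from `P₁` to `P₂`, which has a margin inside the box;
hence it never leaves. -/
theorem exists_solution_Icc (hS : S.weight.PosDef) {P₁ P P₂ : Matrix (Fin n) (Fin n) ℝ}
    (h₁ : P₁.PosDef) (hφ₁ : (S.phi P₁).PosSemidef) (hφ₂ : (-S.phi P₂).PosSemidef)
    (h1 : (P - P₁).PosSemidef) (h2 : (P₂ - P).PosSemidef) {T : ℝ} (hT : 0 ≤ T) :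
    ∃ X : ℝ → Matrix (Fin n) (Fin n) ℝ, X 0 = P ∧ ∀ t ∈ Icc 0 T,
      (X t - P₁).PosSemidef ∧ (P₂ - X t).PosSemidef ∧
        HasDerivWithinAt X (S.phi (X t)) (Icc 0 T) t := by
  have h₂ : P₂.PosSemidef :=
    (posDef_of_posSemidef_sub (posDef_of_posSemidef_sub h₁ h1) h2).posSemidef
  have hPT : Pᵀ = P := (posDef_iff_quad.1 (posDef_of_posSemidef_sub h₁ h1)).1
  obtain ⟨c, hc, hcP⟩ := h₁.exists_pos_mul_le_quad
  set C := ∑ i, ∑ j, |P₂ i j| with hC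
  -- The order interval satisfies the bounds `c` and `C`; relaxing them to `c / 2` and `C + 1`
  -- leaves the margin.
  obtain ⟨ψ, K, L, hψK, hψL, hψs, hψ⟩ :=
    exists_lipschitz_extension_phi hS (half_pos hc).le (C + 1)
  obtain ⟨X, hX0, hXd⟩ := exists_integralCurve_Icc hψK hψL (fun i j => P i j) hT
  have hXe : ∀ t ∈ Icc 0 T, ∀ i j,
      HasDerivWithinAt (fun t => X t i j) (ψ (X t) i j) (Icc 0 T) t := fun t ht i j =>
    hasDerivWithinAt_pi.1 (hasDerivWithinAt_pi.1 (hXd t ht) i) j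
  have hsymm : ∀ t ∈ Icc 0 T, ∀ i j, X t i j = X t j i := by
    intro t ht i j
    have hd : ∀ u ∈ Icc 0 T, HasDerivWithinAt (fun t => X t i j - X t j i) 0 (Icc 0 T) u :=
      fun u hu => by
        have := (hXe u hu i j).sub (hXe u hu j i)
        rwa [hψs (X u) i j, sub_self] at this
    have hconst := constant_of_derivWithin_zero (fun u hu => (hd u hu).differentiableWithinAt)
      (fun u hu => (hd u (Ico_subset_Icc_self hu)).derivWithin
        (uniqueDiffOn_Icc (hu.1.trans_lt hu.2) u (Ico_subset_Icc_self hu))) t ht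
    have hP : P i j = P j i := congrFun (congrFun hPT j) i
    simp only [hX0, hP, sub_self] at hconst
    linarith
  have hcontX : ContinuousOn X (Icc 0 T) := fun t ht => (hXd t ht).continuousWithinAt
  set Y : ℝ → Matrix (Fin n) (Fin n) ℝ := fun t => Matrix.of (X t) with hY
  have hstrict : ∀ Z : Fin n → Fin n → ℝ, (Matrix.of Z - P₁).PosSemidef →
      (P₂ - Matrix.of Z).PosSemidef → ∀ v,
        c * (v ⬝ᵥ v) ≤ quad (Matrix.of Z) v ∧ quad (Matrix.of Z) v ≤ C * (v ⬝ᵥ v) := by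
    intro Z hZ1 hZ2 v
    have a1 := (posSemidef_iff_quad.1 hZ1).2 v
    have a2 := (posSemidef_iff_quad.1 hZ2).2 v
    rw [quad_sub] at a1 a2
    have a3 := hcP v
    have a4 := quad_le_sum_abs P₂ v
    constructor <;> linarith
  have hvv : ∀ v : Fin n → ℝ, 0 ≤ v ⬝ᵥ v := fun v => by
    simpa using dotProduct_star_self_nonneg v
  have hmem0 : X 0 ∈ symmBox n (c / 2) (C + 1) := by
    rw [hX0]
    refine ⟨fun i j => congrFun (congrFun hPT j) i, fun v => ?_⟩
    have := hstrict (fun i j => P i j) h1 h2 v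
    constructor <;> nlinarith [hvv v]
  have hbox : ∀ t, t ≤ T → Icc 0 t ⊆ X ⁻¹' symmBox n (c / 2) (C + 1) →
      (∀ u ∈ Icc 0 t, HasDerivWithinAt Y (S.phi (Y u)) (Icc 0 t) u) ∧
        ∀ u ∈ Icc 0 t, (Y u - P₁).PosSemidef ∧ (P₂ - Y u).PosSemidef := by
    intro t htT hsub
    have hYd : ∀ u ∈ Icc 0 t, HasDerivWithinAt Y (S.phi (Y u)) (Icc 0 t) u := by
      intro u hu
      rw [hasDerivWithinAt_iff_entries]
      intro i j
      have := (hXe u ⟨hu.1, hu.2.trans htT⟩ i j).mono (Icc_subset_Icc_right htT)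
      rwa [hψ _ (hsub hu)] at this
    refine ⟨hYd, ?_⟩
    refine posSemidef_sub_of_phi_sign hS h₁.posSemidef h₂ hφ₁ hφ₂
      (fun u hu => posSemidef_of_mem_symmBox (half_pos hc).le (hsub hu)) hYd ?_ ?_
    · simp only [hY, hX0]
      exact h1
    · simp only [hY, hX0]
      exact h2
  have hinv : Icc 0 T ⊆ X ⁻¹' symmBox n (c / 2) (C + 1) := by
    refine IsClosed.Icc_subset_of_forall_mem_nhdsGT_of_Icc_subset ?_ hmem0 ?_
    · rw [inter_comm]
      exact hcontX.preimage_isClosed_of_isClosed isClosed_Icc (isClosed_symmBox _ _)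
    · intro t ht hsub
      obtain ⟨b1, b2⟩ := (hbox t ht.2.le hsub).2 t (right_mem_Icc.2 ht.1)
      have hb := hstrict (X t) b1 b2
      have hcont : ContinuousWithinAt (fun u => ∑ i, ∑ j, |X u i j - X t i j|) (Ioc t T) t := by
        have hXt : ContinuousWithinAt X (Ioc t T) t :=
          (hcontX t (Ico_subset_Icc_self ht)).mono fun u hu => ⟨ht.1.trans hu.1.le, hu.2⟩
        have hcts : Continuous fun Z : Fin n → Fin n → ℝ => ∑ i, ∑ j, |Z i j - X t i j| := by
          fun_prop
        exact hcts.continuousAt.comp_continuousWithinAt hXt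
      -- A change of this size cannot use up the margins `c / 2` and `1`.
      have hlt : ∀ᶠ u in 𝓝[Ioc t T] t, ∑ i, ∑ j, |X u i j - X t i j| < min (c / 2) 1 := by
        refine hcont.eventually_lt_const ?_
        simp [hc]
      rw [← nhdsWithin_Ioc_eq_nhdsGT ht.2]
      filter_upwards [hlt, self_mem_nhdsWithin] with u hu huT
      have hu0 : u ∈ Icc 0 T := ⟨ht.1.trans huT.1.le, huT.2⟩
      refine ⟨hsymm u hu0, fun v => ?_⟩
      have d1 := quad_le_sum_abs (Matrix.of (X u) - Matrix.of (X t)) v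
      have d2 := quad_le_sum_abs (Matrix.of (X t) - Matrix.of (X u)) v
      rw [quad_sub] at d1 d2
      simp only [Matrix.sub_apply, Matrix.of_apply] at d1 d2
      simp only [abs_sub_comm (X t _ _)] at d2
      have d3 := mul_le_mul_of_nonneg_right (hu.le.trans (min_le_left _ _)) (hvv v)
      have d4 := mul_le_mul_of_nonneg_right (hu.le.trans (min_le_right _ _)) (hvv v)
      have d5 := hb v
      constructor <;> linarith
  obtain ⟨hYd, hYb⟩ := hbox T le_rfl hinv
  refine ⟨Y, ?_, fun t ht => ⟨(hYb t ht).1, (hYb t ht).2, hYd t ht⟩⟩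
  simp only [hY, hX0]
  rfl

theorem exists_solution_Ici (hS : S.weight.PosDef) {P₁ P P₂ : Matrix (Fin n) (Fin n) ℝ}
    (h₁ : P₁.PosDef) (hφ₁ : (S.phi P₁).PosSemidef) (hφ₂ : (-S.phi P₂).PosSemidef)
    (h1 : (P - P₁).PosSemidef) (h2 : (P₂ - P).PosSemidef) :
    ∃ X : ℝ → Matrix (Fin n) (Fin n) ℝ, X 0 = P ∧ ∀ t, 0 ≤ t →
      (X t).PosDef ∧ HasDerivWithinAt X (S.phi (X t)) (Ici 0) t := by
  have hex := fun N : ℕ => exists_solution_Icc hS h₁ hφ₁ hφ₂ h1 h2 (T := N + 1) (by positivity)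
  choose X hX0 hX using hex
  have hpd : ∀ (N : ℕ), ∀ t ∈ Icc (0 : ℝ) (N + 1), (X N t).PosDef := fun N t ht =>
    posDef_of_posSemidef_sub h₁ (hX N t ht).1
  have hagree : ∀ N M : ℕ, ∀ u : ℝ, 0 ≤ u → u ≤ N + 1 → u ≤ M + 1 → X N u = X M u := by
    intro N M u hu hN hM
    exact eq_of_hasDerivWithinAt_phi hS (T := u)
      (fun t ht => (hpd N t ⟨ht.1, ht.2.trans hN⟩).posSemidef)
      (fun t ht => (hpd M t ⟨ht.1, ht.2.trans hM⟩).posSemidef)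
      (fun t ht => hasDerivWithinAt_matrix_mono (hX N t ⟨ht.1, ht.2.trans hN⟩).2.2
        (Icc_subset_Icc_right hN))
      (fun t ht => hasDerivWithinAt_matrix_mono (hX M t ⟨ht.1, ht.2.trans hM⟩).2.2
        (Icc_subset_Icc_right hM))
      (by rw [hX0, hX0]) u (right_mem_Icc.2 hu)
  -- The solution with index `⌈t⌉₊` lives up to `⌈t⌉₊ + 1`, which leaves room to the right of `t`
  -- for the derivative.
  refine ⟨fun t => X ⌈t⌉₊ t, hX0 _, fun t ht => ?_⟩
  have hle : ∀ u : ℝ, u ≤ ⌈u⌉₊ + 1 := fun u => (Nat.le_ceil u).trans (by linarith)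
  have htlt : t < ⌈t⌉₊ + 1 := (Nat.le_ceil t).trans_lt (by linarith)
  refine ⟨hpd _ t ⟨ht, hle t⟩, ?_⟩
  refine hasDerivWithinAt_iff_entries.2 fun i j => ?_
  have hd := (hasDerivWithinAt_iff_entries.1 (hX ⌈t⌉₊ t ⟨ht, hle t⟩).2.2 i j).congr_of_mem
    (f₁ := fun t => X ⌈t⌉₊ t i j)
    (fun u hu => by rw [hagree ⌈u⌉₊ ⌈t⌉₊ u hu.1 (hle u) hu.2]) ⟨ht, hle t⟩
  refine hd.mono_of_mem_nhdsWithin ?_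
  rw [← Ici_inter_Iic]
  exact inter_mem_nhdsWithin _ (Iic_mem_nhds htlt)

theorem isTrajectory_of_hasDerivWithinAt (hS : S.weight.PosDef) {P : Matrix (Fin n) (Fin n) ℝ}
    {X : ℝ → Matrix (Fin n) (Fin n) ℝ} (hX0 : X 0 = P)
    (hX : ∀ t, 0 ≤ t → (X t).PosDef ∧ HasDerivWithinAt X (S.phi (X t)) (Ici 0) t) :
    S.IsTrajectory P X := by
  refine ⟨⟨hX0, fun t ht _ => hX t ht⟩, fun T Y hY t ht htT => ?_⟩
  have hYt : ∀ u ∈ Icc 0 t, (Y u).PosDef ∧ HasDerivWithinAt Y (S.phi (Y u)) (Ici 0) u :=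
    fun u hu => hY.2 u hu.1 (lt_of_le_of_lt (EReal.coe_le_coe_iff.2 hu.2) htT)
  exact eq_of_hasDerivWithinAt_phi hS (T := t) (fun u hu => (hYt u hu).1.posSemidef)
    (fun u hu => (hX u hu.1).1.posSemidef)
    (fun u hu => hasDerivWithinAt_matrix_mono (hYt u hu).2 Icc_subset_Ici_self)
    (fun u hu => hasDerivWithinAt_matrix_mono (hX u hu.1).2 Icc_subset_Ici_self)
    (hY.1.trans hX0.symm) t (right_mem_Icc.2 ht)

/-! ### The algebraic equation -/

theorem exists_posSemidef_phi_smul (hS : S.weight.PosDef) {P : Matrix (Fin n) (Fin n) ℝ}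
    (hP : P.PosDef) : ∃ a : ℝ, 0 < a ∧ a ≤ 1 ∧ (S.phi (a • P)).PosSemidef := by
  have hPT := (posDef_iff_quad.1 hP).1
  obtain ⟨c, hc, hcs⟩ := exists_smul_sub_posSemidef (X := -S.phi P)
    (by rw [Matrix.transpose_neg, transpose_phi hS hPT]) (posDef_schur hS)
  have ha : (0 : ℝ) < 1 / (1 + c) := by positivity
  have ha1 : 1 / (1 + c) ≤ 1 := by
    rw [div_le_one (by positivity)]
    linarith
  -- This `a` solves `1 - a = a * c`, so the Schur term compensates `a • φ(P)`.
  refine ⟨1 / (1 + c), ha, ha1, ?_⟩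
  have h := (posSemidef_phi_smul_sub hS hP.posSemidef ha.le ha1).add (hcs.smul ha.le)
  convert h using 1
  have : 1 - 1 / (1 + c) = 1 / (1 + c) * c := by
    field_simp
    ring
  rw [this]
  module

/-- Since `X s ≤ X 0`, comparing the trajectory with its shift by `s` shows that it decreases, so
its derivative `φ(X t)` is nonpositive. -/
theorem phi_nonpos_of_solution (hS : S.weight.PosDef) {P : Matrix (Fin n) (Fin n) ℝ}
    {X : ℝ → Matrix (Fin n) (Fin n) ℝ} {T : ℝ} (hX0 : X 0 = P)
    (hX : ∀ t ∈ Icc 0 T, (X t).PosSemidef)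
    (hXd : ∀ t ∈ Icc 0 T, HasDerivWithinAt X (S.phi (X t)) (Icc 0 T) t)
    (hle : ∀ t ∈ Icc 0 T, (P - X t).PosSemidef) :
    ∀ t ∈ Ioc 0 T, (-S.phi (X t)).PosSemidef := by
  have hanti : ∀ s ∈ Icc 0 T, ∀ u ∈ Icc 0 (T - s), (X u - X (u + s)).PosSemidef := by
    intro s hs
    have hmaps : MapsTo (fun u => u + s) (Icc 0 (T - s)) (Icc 0 T) := fun u hu =>
      ⟨add_nonneg hu.1 hs.1, by linarith [hu.2]⟩
    have hsub : Icc 0 (T - s) ⊆ Icc 0 T := Icc_subset_Icc_right (by linarith [hs.1])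
    refine posSemidef_sub_of_deriv hS (fun u hu => hX u (hsub hu))
      (fun u hu => hX _ (hmaps hu)) (fun u hu => hasDerivWithinAt_matrix_mono (hXd u (hsub hu)) hsub)
      (V' := fun u => S.phi (X (u + s))) (fun u hu => ?_) (fun u _ => ?_) ?_
    · rw [hasDerivWithinAt_iff_entries]
      intro i j
      have h1 := hasDerivWithinAt_iff_entries.1 (hXd _ (hmaps hu)) i j
      have h2 : HasDerivWithinAt (fun u => u + s) 1 (Icc 0 (T - s)) u :=
        ((hasDerivAt_id u).add_const s).hasDerivWithinAt
      simpa [Function.comp_def] using HasDerivWithinAt.comp u h1 h2 hmaps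
    · simpa using Matrix.PosSemidef.zero
    · rw [zero_add, hX0]
      exact hle s hs
  intro t ht
  have htT := Ioc_subset_Icc_self ht
  refine posSemidef_iff_quad.2 ⟨?_, fun v => ?_⟩
  · rw [Matrix.transpose_neg, transpose_phi hS (posSemidef_iff_quad.1 (hX t htT)).1]
  · rw [quad_neg, neg_nonneg]
    refine deriv_nonpos_of_left_le ht.1 ht.2 (hasDerivWithinAt_quad (hXd t htT) v) fun s hs => ?_
    have := hanti (t - s) ⟨by linarith [hs.2], by linarith [hs.1, ht.2]⟩ s
      ⟨hs.1, by linarith [ht.2]⟩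
    rw [add_sub_cancel] at this
    have := (posSemidef_iff_quad.1 this).2 v
    rw [quad_sub] at this
    linarith

/-- A positive definite supersolution yields a positive definite solution of the algebraic
equation. -/
theorem exists_phi_eq_zero (hS : S.weight.PosDef) {P : Matrix (Fin n) (Fin n) ℝ}
    (hP : P.PosDef) (hφ : (-S.phi P).PosSemidef) :
    ∃ X : Matrix (Fin n) (Fin n) ℝ, X.PosDef ∧ S.phi X = 0 := by
  obtain ⟨a, ha, ha1, hφ₁⟩ := exists_posSemidef_phi_smul hS hP
  set P₁ := a • P with hP₁
  have h₁ : P₁.PosDef := hP.smul ha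
  have h₁P : (P - P₁).PosSemidef := by
    have := hP.posSemidef.smul (sub_nonneg.2 ha1)
    rwa [sub_smul, one_smul] at this
  obtain ⟨c, hc, hcP⟩ := h₁.exists_pos_mul_le_quad
  set C := ∑ i, ∑ j, |P i j|
  -- The supersolutions between `P₁` and `P`. The box is included because continuity of `φ` is known
  -- only there.
  set M : Set (Fin n → Fin n → ℝ) := ⋂ v : Fin n → ℝ, symmBox n c C ∩
    (fun X => (quad (Matrix.of X) v, quad (S.phi (Matrix.of X)) v)) ⁻¹'
      (Icc (quad P₁ v) (quad P v) ×ˢ Iic 0) with hM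
  have hMmem : ∀ X : Fin n → Fin n → ℝ, X ∈ M ↔ (Matrix.of X - P₁).PosSemidef ∧
      (P - Matrix.of X).PosSemidef ∧ (-S.phi (Matrix.of X)).PosSemidef := by
    intro X
    rw [hM, mem_iInter]
    constructor
    · intro h
      have hT : (Matrix.of X)ᵀ = Matrix.of X := by
        ext i j
        exact (h 0).1.1 j i
      refine ⟨posSemidef_iff_quad.2 ⟨?_, fun v => ?_⟩, posSemidef_iff_quad.2 ⟨?_, fun v => ?_⟩,
        posSemidef_iff_quad.2 ⟨?_, fun v => ?_⟩⟩
      · rw [Matrix.transpose_sub, hT, (posDef_iff_quad.1 h₁).1]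
      · rw [quad_sub]
        linarith [(h v).2.1.1]
      · rw [Matrix.transpose_sub, hT, (posDef_iff_quad.1 hP).1]
      · rw [quad_sub]
        linarith [(h v).2.1.2]
      · rw [Matrix.transpose_neg, transpose_phi hS hT]
      · rw [quad_neg, neg_nonneg]
        exact (h v).2.2
    · rintro ⟨a1, a2, a3⟩ v
      have hT := (posDef_iff_quad.1 (posDef_of_posSemidef_sub h₁ a1)).1
      have e1 := fun v => (posSemidef_iff_quad.1 a1).2 v
      have e2 := fun v => (posSemidef_iff_quad.1 a2).2 v
      have e3 := (posSemidef_iff_quad.1 a3).2 v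
      simp only [quad_sub] at e1 e2
      rw [quad_neg] at e3
      refine ⟨⟨fun i j => congrFun (congrFun hT j) i, fun w => ⟨?_, ?_⟩⟩, ⟨?_, ?_⟩, ?_⟩
      · linarith [e1 w, hcP w]
      · linarith [e2 w, quad_le_sum_abs P w]
      · linarith [e1 v]
      · linarith [e2 v]
      · exact neg_nonneg.1 e3
  have hMc : IsCompact M := by
    refine (isCompact_symmBox hc.le C).of_isClosed_subset ?_
      ((iInter_subset _ 0).trans inter_subset_left)
    refine isClosed_iInter fun v => ContinuousOn.preimage_isClosed_of_isClosed ?_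
      (isClosed_symmBox c C) (isClosed_Icc.prod isClosed_Iic)
    refine (continuous_quad_of v).continuousOn.prodMk ?_
    simp only [quad_eq_sum]
    exact continuousOn_finsetSum _ fun i _ => continuousOn_finsetSum _ fun j _ =>
      continuousOn_const.mul ((contDiffOn_phi_entries hS hc.le C i j).continuousOn.mul
        continuousOn_const)
  have hMne : M.Nonempty :=
    ⟨fun i j => P i j, (hMmem _).2 ⟨h₁P, by
      change (P - P).PosSemidef
      rw [sub_self]
      exact Matrix.PosSemidef.zero, hφ⟩⟩
  obtain ⟨X₀, hX₀M, hmin⟩ := hMc.exists_isMinOn hMne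
    (f := fun X : Fin n → Fin n → ℝ => (Matrix.of X).trace)
    (by
      simp only [Matrix.trace, Matrix.diag_apply, Matrix.of_apply]
      fun_prop)
  obtain ⟨b1, b2, b3⟩ := (hMmem X₀).1 hX₀M
  have hX₀pd := posDef_of_posSemidef_sub h₁ b1
  refine ⟨Matrix.of X₀, hX₀pd, ?_⟩
  -- `X₀` is itself a supersolution, so it bounds its own trajectory from above.
  obtain ⟨X, hX0, hX⟩ := exists_solution_Icc hS h₁ hφ₁ b3 b1
    (by rw [sub_self]; exact Matrix.PosSemidef.zero) zero_le_one
  have hneg := phi_nonpos_of_solution hS hX0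
    (fun t ht => (posDef_of_posSemidef_sub h₁ (hX t ht).1).posSemidef)
    (fun t ht => (hX t ht).2.2) (fun t ht => (hX t ht).2.1)
  have hconst : ∀ t ∈ Icc (0 : ℝ) 1, X t = Matrix.of X₀ := by
    intro t ht
    rcases eq_or_lt_of_le ht.1 with h | h
    · rw [← h, hX0]
    · have hmem : (fun i j => X t i j) ∈ M :=
        (hMmem _).2 ⟨(hX t ht).1, posSemidef_sub_trans (hX t ht).2.1 b2, hneg t ⟨h, ht.2⟩⟩
      have htr : (Matrix.of X₀).trace ≤ (X t).trace := hmin hmem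
      have hpsd := (hX t ht).2.1
      have h0 : (Matrix.of X₀ - X t).trace = 0 := by
        refine le_antisymm ?_ hpsd.trace_nonneg
        rw [Matrix.trace_sub]
        linarith
      -- A positive semidefinite matrix of trace zero vanishes.
      exact (sub_eq_zero.1 (hpsd.trace_eq_zero_iff.1 h0)).symm
  have h0mem : (0 : ℝ) ∈ Icc (0 : ℝ) 1 := ⟨le_rfl, zero_le_one⟩
  have hd := (hX 0 h0mem).2.2
  rw [hX0, hasDerivWithinAt_iff_entries] at hd
  ext i j
  have hd2 : HasDerivWithinAt (fun t => X t i j) 0 (Icc 0 1) 0 :=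
    (hasDerivWithinAt_const (0 : ℝ) (Icc 0 1) (Matrix.of X₀ i j)).congr
      (fun t ht => by rw [hconst t ht]) (by rw [hX0])
  exact (uniqueDiffOn_Icc zero_lt_one 0 h0mem).eq_deriv _ (hd i j) hd2

end Coeffs

/-! ### The Thompson metric -/

variable {X Y : Matrix (Fin n) (Fin n) ℝ}

theorem bigM_mem_lowerBounds [Nonempty (Fin n)] (hX : X.PosDef) (hY : Y.PosDef) :
    0 ∈ lowerBounds {t : ℝ | LoewnerLE X (t • Y)} := by
  intro t ht
  have hv : (1 : Fin n → ℝ) ≠ 0 := one_ne_zero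
  have h1 := (posSemidef_iff_quad.1 ht).2 1
  rw [quad_sub, quad_smul] at h1
  have h2 := (posDef_iff_quad.1 hX).2 1 hv
  have h3 := (posDef_iff_quad.1 hY).2 1 hv
  by_contra hcon
  nlinarith

theorem bigM_le [Nonempty (Fin n)] (hX : X.PosDef) (hY : Y.PosDef) {t : ℝ}
    (h : (t • Y - X).PosSemidef) : bigM X Y ≤ t :=
  csInf_le ⟨0, bigM_mem_lowerBounds hX hY⟩ h

/-- Each quotient `quad X v / quad Y v` is a lower bound of the admissible `t`, so the infimum is
attained. -/
theorem posSemidef_bigM_smul_sub (hX : X.PosDef) (hY : Y.PosDef) :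
    (bigM X Y • Y - X).PosSemidef := by
  have hXT := (posDef_iff_quad.1 hX).1
  have hYT := (posDef_iff_quad.1 hY).1
  refine posSemidef_iff_quad.2 ⟨?_, fun v => ?_⟩
  · rw [Matrix.transpose_sub, Matrix.transpose_smul, hXT, hYT]
  · by_cases hv : v = 0
    · simp [hv, quad]
    have hYv := (posDef_iff_quad.1 hY).2 v hv
    obtain ⟨t, -, ht⟩ := exists_smul_sub_posSemidef hXT hY
    have : quad X v / quad Y v ≤ bigM X Y := by
      refine le_csInf ⟨t, ht⟩ fun s hs => ?_
      have h1 := (posSemidef_iff_quad.1 hs).2 v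
      rw [quad_sub, quad_smul] at h1
      rw [div_le_iff₀ hYv]
      linarith
    rw [div_le_iff₀ hYv] at this
    rw [quad_sub, quad_smul]
    linarith

theorem bigM_pos [Nonempty (Fin n)] (hX : X.PosDef) (hY : Y.PosDef) : 0 < bigM X Y := by
  have hv : (1 : Fin n → ℝ) ≠ 0 := one_ne_zero
  have h1 := (posSemidef_iff_quad.1 (posSemidef_bigM_smul_sub hX hY)).2 1
  rw [quad_sub, quad_smul] at h1
  have h2 := (posDef_iff_quad.1 hX).2 1 hv
  have h3 := (posDef_iff_quad.1 hY).2 1 hv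
  by_contra hcon
  nlinarith

theorem dT_le [Nonempty (Fin n)] (hX : X.PosDef) (hY : Y.PosDef) {l : ℝ}
    (h1 : (Real.exp l • Y - X).PosSemidef) (h2 : (Real.exp l • X - Y).PosSemidef) :
    dT X Y ≤ l := by
  rw [dT, Real.log_le_iff_le_exp (lt_max_of_lt_left (bigM_pos hX hY))]
  exact max_le (bigM_le hX hY h1) (bigM_le hY hX h2)

theorem dT_comm (X Y : Matrix (Fin n) (Fin n) ℝ) : dT X Y = dT Y X := by
  rw [dT, dT, max_comm]

theorem posSemidef_exp_dT_smul_sub [Nonempty (Fin n)] (hX : X.PosDef) (hY : Y.PosDef) :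
    (Real.exp (dT X Y) • Y - X).PosSemidef := by
  rw [dT, Real.exp_log (lt_max_of_lt_left (bigM_pos hX hY))]
  refine posSemidef_sub_trans (posSemidef_bigM_smul_sub hX hY) ?_
  rw [← sub_smul]
  exact hY.posSemidef.smul (sub_nonneg.2 (le_max_left _ _))

theorem dT_self (hX : X.PosDef) : dT X X = 0 := by
  rcases isEmpty_or_nonempty (Fin n) with h | h
  -- In dimension zero every `t` is admissible; the default values `sInf univ = 0` and `log 0 = 0`
  -- give the claim.
  · have : {t : ℝ | LoewnerLE X (t • X)} = univ := eq_univ_of_forall fun t => by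
      change (t • X - X).PosSemidef
      rw [Subsingleton.elim (t • X - X) 0]
      exact Matrix.PosSemidef.zero
    simp [dT, bigM, this]
  · refine le_antisymm (dT_le hX hX ?_ ?_) ?_
    · simpa using Matrix.PosSemidef.zero
    · simpa using Matrix.PosSemidef.zero
    · have h1 := (posSemidef_iff_quad.1 (posSemidef_exp_dT_smul_sub hX hX)).2 1
      rw [quad_sub, quad_smul] at h1
      have h2 := (posDef_iff_quad.1 hX).2 1 one_ne_zero
      have h3 : 1 ≤ Real.exp (dT X X) := by
        by_contra hcon
        nlinarith
      exact Real.one_le_exp_iff.1 h3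

theorem dT_pos (hX : X.PosDef) (hY : Y.PosDef) (hne : X ≠ Y) : 0 < dT X Y := by
  rcases isEmpty_or_nonempty (Fin n) with h | h
  · exact absurd (Subsingleton.elim X Y) hne
  by_contra hcon
  rw [not_lt] at hcon
  have key : ∀ {X Y : Matrix (Fin n) (Fin n) ℝ}, X.PosDef → Y.PosDef → dT X Y ≤ 0 →
      (Y - X).PosSemidef := by
    intro X Y hX hY hd
    refine posSemidef_sub_trans (posSemidef_exp_dT_smul_sub hX hY) ?_
    have := hY.posSemidef.smul (sub_nonneg.2 (Real.exp_le_one_iff.2 hd))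
    rwa [sub_smul, one_smul] at this
  exact hne (eq_of_posSemidef_sub (key hX hY hcon) (key hY hX (dT_comm X Y ▸ hcon)))

theorem posSemidef_sub_smallM_smul (hX : X.PosDef) (hY : Y.PosDef) :
    (X - smallM X Y • Y).PosSemidef := by
  have hXT := (posDef_iff_quad.1 hX).1
  have hYT := (posDef_iff_quad.1 hY).1
  refine posSemidef_iff_quad.2 ⟨?_, fun v => ?_⟩
  · rw [Matrix.transpose_sub, Matrix.transpose_smul, hXT, hYT]
  · by_cases hv : v = 0
    · simp [hv, quad]
    have hYv := (posDef_iff_quad.1 hY).2 v hv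
    have : smallM X Y ≤ quad X v / quad Y v := by
      refine csSup_le ⟨0, ?_⟩ fun s hs => ?_
      · change (X - (0 : ℝ) • Y).PosSemidef
        simpa using hX.posSemidef
      have h1 := (posSemidef_iff_quad.1 hs).2 v
      rw [quad_sub, quad_smul] at h1
      rw [le_div_iff₀ hYv]
      linarith
    rw [le_div_iff₀ hYv] at this
    rw [quad_sub, quad_smul]
    linarith

theorem smallM_pos [Nonempty (Fin n)] (hX : X.PosDef) (hY : Y.PosDef) : 0 < smallM X Y := by
  have hv : (1 : Fin n → ℝ) ≠ 0 := one_ne_zero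
  obtain ⟨t, ht, hts⟩ := exists_smul_sub_posSemidef (posDef_iff_quad.1 hY).1 hX
  have hbdd : BddAbove {t : ℝ | LoewnerLE (t • Y) X} := by
    refine ⟨quad X 1 / quad Y 1, fun s hs => ?_⟩
    have h1 := (posSemidef_iff_quad.1 hs).2 1
    rw [quad_sub, quad_smul] at h1
    rw [le_div_iff₀ ((posDef_iff_quad.1 hY).2 1 hv)]
    linarith
  refine (inv_pos.2 ht).trans_le (le_csSup hbdd ?_)
  have := hts.smul (inv_pos.2 ht).le
  rwa [smul_sub, smul_smul, inv_mul_cancel₀ ht.ne', one_smul] at this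

/-! ### Exponential contraction -/

/-- Convexity of `exp` between `-d` and `0`. It lets the rate fixed at the initial distance `d`
serve at all smaller distances. -/
theorem one_sub_exp_neg_mul_le (d : ℝ) {θ : ℝ} (h0 : 0 ≤ θ) (h1 : θ ≤ 1) :
    θ * (1 - Real.exp (-d)) ≤ 1 - Real.exp (-(d * θ)) := by
  have := convexOn_exp.2 (mem_univ 0) (mem_univ (-d)) (sub_nonneg.2 h1) h0 (by ring)
  simp only [smul_eq_mul, mul_zero, zero_add, Real.exp_zero] at this
  rw [show θ * -d = -(d * θ) by ring] at this
  linarith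

namespace Coeffs

variable {S : Coeffs n k} {P Pbar : Matrix (Fin n) (Fin n) ℝ}

theorem rate_pos (hS : S.weight.PosDef) (hP : P.PosDef) (hPbar : Pbar.PosDef) (hne : P ≠ Pbar) :
    0 < S.rate P Pbar := by
  have : Nonempty (Fin n) := by
    by_contra h
    rw [not_nonempty_iff] at h
    exact hne (Subsingleton.elim P Pbar)
  have hd := dT_pos hP hPbar hne
  refine mul_pos (div_pos ?_ hd) (smallM_pos (posDef_schur hS) hPbar)
  rw [sub_pos, Real.exp_lt_one_iff]
  linarith

/-- `Q - L'R⁻¹L ≥ m P̄` turns the concavity defect into a multiple of `P̄`. Taking `b = 0` gives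
stationary barriers, `b > 0` moving ones. -/
theorem posSemidef_phi_smul_of_le_one (hS : S.weight.PosDef) (hPbar : Pbar.PosDef)
    (h0 : S.phi Pbar = 0) {a b : ℝ} (ha0 : 0 ≤ a) (ha1 : a ≤ 1)
    (hb : b ≤ (1 - a) * smallM S.schur Pbar) : (S.phi (a • Pbar) - b • Pbar).PosSemidef := by
  have h1 := posSemidef_phi_smul_sub hS hPbar.posSemidef ha0 ha1
  have h2 := (posSemidef_sub_smallM_smul (posDef_schur hS) hPbar).smul (sub_nonneg.2 ha1)
  have h3 := hPbar.posSemidef.smul (sub_nonneg.2 hb)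
  convert (h1.add h2).add h3 using 1
  rw [h0]
  module

theorem posSemidef_neg_phi_smul_of_one_le (hS : S.weight.PosDef) (hPbar : Pbar.PosDef)
    (h0 : S.phi Pbar = 0) {a b : ℝ} (ha1 : 1 ≤ a)
    (hb : b ≤ (a - 1) * smallM S.schur Pbar) : (-b • Pbar - S.phi (a • Pbar)).PosSemidef := by
  have h1 := posSemidef_sub_phi_smul hS hPbar.posSemidef ha1
  have h2 := (posSemidef_sub_smallM_smul (posDef_schur hS) hPbar).smul (sub_nonneg.2 ha1)
  have h3 := hPbar.posSemidef.smul (sub_nonneg.2 hb)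
  convert (h1.add h2).add h3 using 1
  rw [h0]
  module

/-- Exponential contraction towards the solution of the algebraic equation. -/
theorem dT_le_exp_rate (hS : S.weight.PosDef) (hP : P.PosDef) (hPbar : Pbar.PosDef)
    (hφ : S.phi Pbar = 0) (hne : P ≠ Pbar) {X : ℝ → Matrix (Fin n) (Fin n) ℝ} (hX0 : X 0 = P)
    (hX : ∀ t, 0 ≤ t → (X t).PosDef ∧ HasDerivWithinAt X (S.phi (X t)) (Ici 0) t)
    {t : ℝ} (ht : 0 ≤ t) :
    dT (X t) Pbar ≤ Real.exp (-S.rate P Pbar * t) * dT P Pbar := by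
  have hn : Nonempty (Fin n) := by
    by_contra h
    rw [not_nonempty_iff] at h
    exact hne (Subsingleton.elim P Pbar)
  have hα := rate_pos hS hP hPbar hne
  have hd := dT_pos hP hPbar hne
  have hαeq : S.rate P Pbar * dT P Pbar =
      (1 - Real.exp (-dT P Pbar)) * smallM S.schur Pbar := by
    rw [rate, schur]
    field_simp
  have hm := smallM_pos (posDef_schur hS) hPbar
  have hPle := posSemidef_exp_dT_smul_sub hP hPbar
  have hleP := posSemidef_exp_dT_smul_sub hPbar hP
  rw [dT_comm Pbar P] at hleP
  set α := S.rate P Pbar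
  set d := dT P Pbar
  set m := smallM S.schur Pbar
  -- The claimed bound on the distance; `exp (±l s) • Pbar` will be the barriers.
  set l : ℝ → ℝ := fun s => d * Real.exp (-α * s) with hl
  have hl0 : ∀ s, 0 < l s := fun s => by positivity
  have hld : ∀ s, HasDerivAt l (-(α * l s)) s := fun s => by
    have := (((hasDerivAt_id s).const_mul (-α)).exp).const_mul d
    have he : -(α * l s) = d * (Real.exp (-α * s) * (-α * 1)) := by
      simp only [hl]
      ring
    rw [he]
    exact this
  have hrate : ∀ s, 0 ≤ s → α * l s ≤ (1 - Real.exp (-l s)) * m := by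
    intro s hs
    have hθ : Real.exp (-α * s) ≤ 1 := Real.exp_le_one_iff.2 (by nlinarith)
    have h1 := mul_le_mul_of_nonneg_right
      (one_sub_exp_neg_mul_le d (Real.exp_pos (-α * s)).le hθ) hm.le
    calc α * l s = Real.exp (-α * s) * (α * d) := by simp only [hl]; ring
      _ = Real.exp (-α * s) * (1 - Real.exp (-d)) * m := by rw [hαeq]; ring
      _ ≤ _ := h1
  have hXd : ∀ s ∈ Icc 0 t, HasDerivWithinAt X (S.phi (X s)) (Icc 0 t) s := fun s hs =>
    hasDerivWithinAt_matrix_mono (hX s hs.1).2 Icc_subset_Ici_self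
  have hXp : ∀ s ∈ Icc 0 t, (X s).PosSemidef := fun s hs => (hX s hs.1).1.posSemidef
  have hupper : ((Real.exp (l t)) • Pbar - X t).PosSemidef := by
    refine posSemidef_sub_of_deriv hS (U := fun s => Real.exp (l s) • Pbar)
      (U' := fun s => (Real.exp (l s) * -(α * l s)) • Pbar)
      (fun s _ => hPbar.posSemidef.smul (Real.exp_pos _).le) hXp (fun s _ => ?_) hXd
      (fun s hs => ?_) ?_ t (right_mem_Icc.2 ht)
    · rw [hasDerivWithinAt_iff_entries]
      exact fun i j => ((hld s).exp.hasDerivWithinAt).mul_const _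
    · rw [sub_self, sub_zero, mul_neg]
      refine posSemidef_neg_phi_smul_of_one_le hS hPbar hφ (Real.one_le_exp (hl0 s).le) ?_
      have h1 := mul_le_mul_of_nonneg_left (hrate s hs.1) (Real.exp_pos (l s)).le
      -- The upper barrier needs `hrate` multiplied by `exp (l s)`, with no slack.
      have h2 : Real.exp (l s) * Real.exp (-l s) = 1 := by rw [← Real.exp_add]; simp
      calc _ ≤ _ := h1
        _ = (Real.exp (l s) - Real.exp (l s) * Real.exp (-l s)) * m := by ring
        _ = _ := by rw [h2]
    · simpa [hl, hX0] using hPle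
  have hlower : (X t - (Real.exp (-l t)) • Pbar).PosSemidef := by
    refine posSemidef_sub_of_deriv hS (V := fun s => Real.exp (-l s) • Pbar)
      (V' := fun s => (Real.exp (-l s) * (α * l s)) • Pbar)
      hXp (fun s _ => hPbar.posSemidef.smul (Real.exp_pos _).le) hXd (fun s _ => ?_)
      (fun s hs => ?_) ?_ t (right_mem_Icc.2 ht)
    · rw [hasDerivWithinAt_iff_entries]
      intro i j
      have := ((hld s).neg.exp.hasDerivWithinAt (s := Icc 0 t)).mul_const (Pbar i j)
      rwa [neg_neg] at this
    · rw [sub_self, zero_sub, neg_sub]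
      have he : Real.exp (-l s) ≤ 1 := Real.exp_le_one_iff.2 (by linarith [hl0 s])
      refine posSemidef_phi_smul_of_le_one hS hPbar hφ (Real.exp_pos _).le he ?_
      -- The lower barrier has slack: the factor `exp (-l s) ≤ 1` is discarded.
      have h1 : Real.exp (-l s) * (α * l s) ≤ α * l s :=
        mul_le_of_le_one_left (mul_pos hα (hl0 s)).le he
      exact h1.trans (hrate s hs.1)
    · have := hleP.smul (Real.exp_pos (-d)).le
      rw [smul_sub, smul_smul, ← Real.exp_add, neg_add_cancel, Real.exp_zero, one_smul] at this
      simpa [hl, hX0] using this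
  rw [mul_comm]
  refine dT_le (hX t ht).1 hPbar hupper ?_
  have := hlower.smul (Real.exp_pos (l t)).le
  rwa [smul_sub, smul_smul, ← Real.exp_add, add_neg_cancel, Real.exp_zero, one_smul] at this

theorem hasDerivWithinAt_const_of_phi_eq_zero (hPbar : Pbar.PosDef) (hφ : S.phi Pbar = 0) :
    ∀ t : ℝ, 0 ≤ t → Pbar.PosDef ∧
      HasDerivWithinAt (fun _ : ℝ => Pbar) (S.phi Pbar) (Ici 0) t := fun t _ =>
  ⟨hPbar, hφ ▸ hasDerivWithinAt_matrix_const Pbar _ t⟩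

/-- A second zero would be a constant trajectory whose positive distance to `Pbar` strictly shrinks.
-/
theorem eq_of_phi_eq_zero (hS : S.weight.PosDef) (hP : P.PosDef) (hPbar : Pbar.PosDef)
    (hφP : S.phi P = 0) (hφ : S.phi Pbar = 0) : P = Pbar := by
  by_contra hne
  have h := dT_le_exp_rate hS hP hPbar hφ hne rfl
    (hasDerivWithinAt_const_of_phi_eq_zero hP hφP) zero_le_one
  have hd := dT_pos hP hPbar hne
  have h1 : Real.exp (-S.rate P Pbar * 1) < 1 :=
    Real.exp_lt_one_iff.2 (by linarith [rate_pos hS hP hPbar hne])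
  nlinarith

end Coeffs

end GenRiccati

/-! ### The main theorem -/

theorem mainTheorem4 (n k : ℕ) (S : GenRiccati.Coeffs n k) (hS : S.weight.PosDef) :
    ((∃ Pbar : Matrix (Fin n) (Fin n) ℝ, Pbar.PosDef ∧ S.GARE Pbar) ↔
      ∃ P0 : Matrix (Fin n) (Fin n) ℝ, P0.PosDef ∧ GenRiccati.LoewnerLE (S.phi P0) 0) ∧
    ∀ Pbar : Matrix (Fin n) (Fin n) ℝ, Pbar.PosDef → S.GARE Pbar →
      (∀ P : Matrix (Fin n) (Fin n) ℝ, P.PosDef → S.GARE P → P = Pbar) ∧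
      ∀ P : Matrix (Fin n) (Fin n) ℝ, P.PosDef →
        ∃ X : ℝ → Matrix (Fin n) (Fin n) ℝ, S.IsTrajectory P X ∧
          ∃ α : ℝ, 0 < α ∧ (P ≠ Pbar → 0 < S.rate P Pbar ∧ S.rate P Pbar ≤ α) ∧
            ∀ t : ℝ, 0 ≤ t →
              GenRiccati.dT (X t) Pbar ≤ Real.exp (-α * t) * GenRiccati.dT P Pbar := by
  open GenRiccati GenRiccati.Coeffs in
  refine ⟨⟨fun ⟨P, hP, hG⟩ => ⟨P, hP, ?_⟩, fun ⟨P, hP, hle⟩ => ?_⟩,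
    fun Pbar hPbar hG => ⟨fun P hP hGP => eq_of_phi_eq_zero hS hP hPbar hGP.1 hG.1,
      fun P hP => ?_⟩⟩
  · rw [LoewnerLE, hG.1, sub_zero]
    exact Matrix.PosSemidef.zero
  · obtain ⟨X, hX, hφ⟩ := exists_phi_eq_zero hS hP (by rwa [LoewnerLE, zero_sub] at hle)
    exact ⟨X, hX, hφ, posDef_denom hS hX.posSemidef⟩
  · by_cases hne : P = Pbar
    · subst hne
      -- Both distances are zero here, so any positive `α` will do.
      refine ⟨fun _ => P, isTrajectory_of_hasDerivWithinAt hS rfl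
        (hasDerivWithinAt_const_of_phi_eq_zero hP hG.1), 1, one_pos, fun h => absurd rfl h,
        fun t _ => ?_⟩
      rw [dT_self hP, mul_zero]
    · have : Nonempty (Fin n) := by
        by_contra h
        rw [not_nonempty_iff] at h
        exact hne (Subsingleton.elim P Pbar)
      have hd := dT_pos hP hPbar hne
      have hm := smallM_pos (posDef_schur hS) hPbar
      have he : Real.exp (-dT P Pbar) ≤ 1 := Real.exp_le_one_iff.2 (by linarith)
      have he' : 1 ≤ Real.exp (dT P Pbar) := Real.one_le_exp hd.le
      -- With `d = dT P Pbar`, the matrices `exp (∓d) • Pbar` are a sub- and a supersolution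
      -- enclosing `P`.
      have hφ₁ := posSemidef_phi_smul_of_le_one hS hPbar hG.1 (b := 0) (Real.exp_pos _).le he
        (mul_nonneg (sub_nonneg.2 he) hm.le)
      have hφ₂ := posSemidef_neg_phi_smul_of_one_le hS hPbar hG.1 (b := 0) he'
        (mul_nonneg (sub_nonneg.2 he') hm.le)
      rw [zero_smul, sub_zero] at hφ₁
      rw [neg_zero, zero_smul, zero_sub] at hφ₂
      have hle := (posSemidef_exp_dT_smul_sub hPbar hP).smul (Real.exp_pos (-dT P Pbar)).le
      rw [dT_comm Pbar P, smul_sub, smul_smul, ← Real.exp_add, neg_add_cancel, Real.exp_zero,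
        one_smul] at hle
      obtain ⟨X, hX0, hX⟩ := exists_solution_Ici hS (hPbar.smul (Real.exp_pos _)) hφ₁ hφ₂ hle
        (posSemidef_exp_dT_smul_sub hP hPbar)
      have hα := rate_pos hS hP hPbar hne
      exact ⟨X, isTrajectory_of_hasDerivWithinAt hS hX0 hX, S.rate P Pbar, hα,
        fun _ => ⟨hα, le_rfl⟩, fun t ht => dT_le_exp_rate hS hP hPbar hG.1 hne hX0 hX ht⟩
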